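/- \textbf{Theorem 1 (Variance estimators).} For $p_n\times p_n$ matrices put $\langle A,B\rangle_n=\mathrm{Tr}(AB^T)/p_n$ and $\|A\|_n=\sqrt{\mathrm{Tr}(AA^T)/p_n}$. For each $n\ge 1$ let $X_n\in\mathbb R^{p_n\times n}$ ($p_n\ge1$) have i.i.d. columns $X^n_1,\dots,X^n_n$ with mean $m_n$ and covariance matrix $\Sigma_n=\Gamma_n\Lambda_n\Gamma_n^T$ ($\Lambda_n$ diagonal, $\Gamma_n$ orthogonal), let $y^n=\Gamma_n^TX^n_1$ with coordinates $y^n_i$, and put $\tilde y^n_i=y^n_i-\mathbb E[y^n_i]$. Let $T_n^{(1)},\dots,T_n^{(N_n)}$ ($N_n\ge1$) be symmetric $p_n\times p_n$ matrices, orthonormal for $\langle\cdot,\cdot\rangle_n$. Assume: \begin{enumerate} \item there is $K_1$ independent of $n$ with $p_n/n\le K_1$; \item there is $K_2$ independent of $n$ with $\frac1{p_n}\sum_{i=1}^{p_n}\mathbb E[(y^n_i)^8]\le K_2$ and $\mathbb E[\langle X^n_1(X^n_1)^T,T_n^{(k)}\rangle_n^4]\le K_2$ for all $k\le N_n$ (all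 these expectations being finite); \item $N_n=o(n)$; \item $\frac{p_n^2}{n}\cdot\frac1{|Q_n|}\sum_{(i,j,k,l)\in Q_n}\mathrm{Cov}[\tilde y^n_i\tilde y^n_j,\tilde y^n_k\tilde y^n_l]^2\to0$, where $Q_n$ is the set of quadruples of four distinct integers between $1$ and $p_n$ (the average is read as $0$ if $p_n<4$). \end{enumerate} Consider either of the following two settings. \emph{Known mean.} Let $Z_k=X^n_k-m_n$, $S_n=\frac1n\sum_{k=1}^n Z_kZ_k^T$, $$\hat{\mathbb V}(S_n)=\frac1{n(n-1)}\sum_{k=1}^n\|Z_kZ_k^T-S_n\|_n^2,\qquad \hat{\mathbb V}(\langle S_n,T\rangle_n)=\frac1{n(n-1)}\sum_{k=1}^n\langle Z_kZ_k^T-S_n,T\rangle_n^2 .$$ \emph{Unknown mean.} Let $\tilde X_k=X^n_k-\frac1n\sum_{l=1}^nX^n_l$, $S_n=\frac1{n-1}\sum_{k=1}^n\tilde X_k\tilde X_k^T$, $\bar b_n^2=\frac1{n^2}\sum_{k=1}^n\|\frac n{n-1}\tilde X_k\tilde X_k^T-S_n\|_n^2$, $\bar b_{T,n}^2=\frac{p_n}{(n-1)^2}\sum_{k=1}^n\langle\tilde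 X_k\tilde X_k^T,T\rangle_n^2-\frac1n\langle S_nT,TS_n\rangle_n$, $$\hat{\mathbb V}(S_n)=\frac{(n-1)^2}{(n-2)(n-3)}\bar b_n^2-\frac1{n(n-2)}\|S_n\|_n^2-\frac{n-1}{n(n-2)(n-3)}\,p_n\langle S_n,I_{p_n}\rangle_n^2,$$ $$\hat{\mathbb V}(\langle S_n,T\rangle_n)=\frac{(n-1)^2}{p_n(n-2)(n-3)}\bar b_{T,n}^2+\frac{n-1}{p_nn(n-2)}\langle S_nT,TS_n\rangle_n-\frac{n^2-2n-1}{n(n-2)(n-3)}\langle S_n,T\rangle_n^2 .$$ Put $\mathbb V(S_n)=\mathbb E[\|S_n-\Sigma_n\|_n^2]$ and $\mathbb V(\langle S_n,T\rangle_n)=\mathbb E[\langle S_n-\Sigma_n,T\rangle_n^2]$. Then, in each of the two settings, for every $n\ge2$ (known mean), respectively every $n\ge4$ (unknown mean), these quantities are finite, and for all $i\le N_n$ $$\mathbb E[\hat{\mathbb V}(S_n)]=\mathbb V(S_n),\qquad \mathbb E[\hat{\mathbb V}(\langle S_n,T_n^{(i)}\rangle_n)]=\mathbb V(\langle S_n,T_n^{(i)}\rangle_n).$$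 Moreover, as $n\to\infty$, $$\mathbb E\Big[\big(\hat{\mathbb V}(S_n)-\mathbb V(S_n)\big)^2\Big]\to0,\qquad \mathbb E\Big[\Big(\sum_{i=1}^{N_n}\big(\hat{\mathbb V}(\langle S_n,T_n^{(i)}\rangle_n)-\mathbb V(\langle S_n,T_n^{(i)}\rangle_n)\big)\Big)^2\Big]\to0 .$$ -/

import Mathlib

open MeasureTheory ProbabilityTheory Filter Asymptotics
open scoped Topology Matrix

noncomputable section

namespace Shrinkage

/-! Deterministic notions. Observations form a `p × n` real matrix, one sample per column. -/

/-- The inner product `⟨A, B⟩ = Tr(A Bᵀ) / p` on `p × p` matrices. -/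
def inner {p : ℕ} (A B : Matrix (Fin p) (Fin p) ℝ) : ℝ :=
  (A * Bᵀ).trace / (p : ℝ)

/-- The associated norm `‖A‖ = √(Tr(A Aᵀ) / p)`. -/
def norm {p : ℕ} (A : Matrix (Fin p) (Fin p) ℝ) : ℝ :=
  Real.sqrt ((A * Aᵀ).trace / (p : ℝ))

/-- The rank-one matrix `x_k x_kᵀ`, where `x_k` is the `k`-th column of `x`. -/
def outer {p n : ℕ} (x : Matrix (Fin p) (Fin n) ℝ) (k : Fin n) : Matrix (Fin p) (Fin p) ℝ :=
  Matrix.vecMulVec (fun i => x i k) (fun i => x i k)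

/-- The observations with the vector `m` subtracted from every column. -/
def centerAt {p n : ℕ} (m : Fin p → ℝ) (x : Matrix (Fin p) (Fin n) ℝ) :
    Matrix (Fin p) (Fin n) ℝ :=
  Matrix.of fun i k => x i k - m i

/-- The observations with the empirical mean subtracted from every column. -/
def centerEmp {p n : ℕ} (x : Matrix (Fin p) (Fin n) ℝ) : Matrix (Fin p) (Fin n) ℝ :=
  Matrix.of fun i k => x i k - (1 / (n : ℝ)) * ∑ l : Fin n, x i l

/-! Known mean `m`. -/

/-- Empirical covariance when the mean `m` is known. -/
def covKnown {p n : ℕ} (m : Fin p → ℝ) (x : Matrix (Fin p) (Fin n) ℝ) :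
    Matrix (Fin p) (Fin p) ℝ :=
  (1 / (n : ℝ)) • (centerAt m x * (centerAt m x)ᵀ)

/-- Estimator of the variance of the empirical covariance, known mean. -/
def vhatKnown {p n : ℕ} (m : Fin p → ℝ) (x : Matrix (Fin p) (Fin n) ℝ) : ℝ :=
  1 / ((n : ℝ) * ((n : ℝ) - 1)) *
    ∑ k : Fin n, norm (outer (centerAt m x) k - covKnown m x) ^ 2

/-- Estimator of the variance of the coordinate along the target `T`, known mean. -/
def vhatTargetKnown {p n : ℕ} (m : Fin p → ℝ) (T : Matrix (Fin p) (Fin p) ℝ)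
    (x : Matrix (Fin p) (Fin n) ℝ) : ℝ :=
  ∑ k : Fin n, inner (outer (centerAt m x) k - covKnown m x) T ^ 2 / ((n : ℝ) * ((n : ℝ) - 1))

/-! Unknown mean. -/

/-- Unbiased sample covariance when the mean is unknown. -/
def covUnknown {p n : ℕ} (x : Matrix (Fin p) (Fin n) ℝ) : Matrix (Fin p) (Fin p) ℝ :=
  (1 / ((n : ℝ) - 1)) • (centerEmp x * (centerEmp x)ᵀ)

/-- The auxiliary quantity `b̄²`. -/
def bbar {p n : ℕ} (x : Matrix (Fin p) (Fin n) ℝ) : ℝ :=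
  1 / (n : ℝ) ^ 2 *
    ∑ k : Fin n, norm (((n : ℝ) / ((n : ℝ) - 1)) • outer (centerEmp x) k - covUnknown x) ^ 2

/-- Estimator of the variance of the sample covariance, unknown mean. -/
def vhatUnknown {p n : ℕ} (x : Matrix (Fin p) (Fin n) ℝ) : ℝ :=
  ((n : ℝ) - 1) ^ 2 / (((n : ℝ) - 2) * ((n : ℝ) - 3)) * bbar x
    - 1 / ((n : ℝ) * ((n : ℝ) - 2)) * norm (covUnknown x) ^ 2
    - ((n : ℝ) - 1) / ((n : ℝ) * ((n : ℝ) - 2) * ((n : ℝ) - 3)) *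
        ((p : ℝ) * inner (covUnknown x) 1 ^ 2)

/-- The auxiliary quantity `b̄_T²`. -/
def bbarTarget {p n : ℕ} (T : Matrix (Fin p) (Fin p) ℝ) (x : Matrix (Fin p) (Fin n) ℝ) : ℝ :=
  (p : ℝ) / ((n : ℝ) - 1) ^ 2 * ∑ k : Fin n, inner (outer (centerEmp x) k) T ^ 2
    - 1 / (n : ℝ) * inner (covUnknown x * T) (T * covUnknown x)

/-- Estimator of the variance of the coordinate along the target `T`, unknown mean. -/
def vhatTargetUnknown {p n : ℕ} (T : Matrix (Fin p) (Fin p) ℝ)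
    (x : Matrix (Fin p) (Fin n) ℝ) : ℝ :=
  ((n : ℝ) - 1) ^ 2 / ((p : ℝ) * ((n : ℝ) - 2) * ((n : ℝ) - 3)) * bbarTarget T x
    + ((n : ℝ) - 1) / ((p : ℝ) * (n : ℝ) * ((n : ℝ) - 2)) *
        inner (covUnknown x * T) (T * covUnknown x)
    - ((n : ℝ) ^ 2 - 2 * (n : ℝ) - 1) / ((n : ℝ) * ((n : ℝ) - 2) * ((n : ℝ) - 3)) *
        inner (covUnknown x) T ^ 2

/-! Probabilistic notions. `ν` is the common law of the samples on `ℝᵖ`. -/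

/-- Population mean. -/
def popMean {p : ℕ} (ν : Measure (Fin p → ℝ)) : Fin p → ℝ :=
  fun i => ∫ x, x i ∂ν

/-- Population covariance matrix. -/
def popCov {p : ℕ} (ν : Measure (Fin p → ℝ)) : Matrix (Fin p) (Fin p) ℝ :=
  Matrix.of fun i j => cov[fun x => x i, fun x => x j; ν]

/-- The columns of `X` are i.i.d. with law `ν`. -/
def IsIIDSample {Ω : Type*} [MeasurableSpace Ω] {p n : ℕ} (P : Measure Ω)
    (X : Ω → Matrix (Fin p) (Fin n) ℝ) (ν : Measure (Fin p → ℝ)) : Prop :=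
  (∀ k, HasLaw (fun ω i => X ω i k) ν P) ∧ iIndepFun (fun k ω i => X ω i k) P

/-- `A = G diag(lam) Gᵀ` with `G` orthogonal. -/
def IsSpectralDecomposition {p : ℕ} (A G : Matrix (Fin p) (Fin p) ℝ) (lam : Fin p → ℝ) : Prop :=
  G ∈ Matrix.orthogonalGroup (Fin p) ℝ ∧ A = G * Matrix.diagonal lam * Gᵀ

/-- An orthonormal (hence linearly independent) family of symmetric targets. -/
def IsTargetFamily {p N : ℕ} (T : Fin N → Matrix (Fin p) (Fin p) ℝ) : Prop :=
  (∀ k, (T k).IsSymm) ∧ ∀ k l, inner (T k) (T l) = if k = l then 1 else 0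

/-- The dimension is at most of the order of the sample size. -/
def DimensionAssumption (p : ℕ → ℕ) : Prop :=
  ∃ K₁ : ℝ, ∀ n : ℕ, 1 ≤ n → (p n : ℝ) / (n : ℝ) ≤ K₁

/-- Bounded eighth moments of `y = Gᵀ x`, averaged over the coordinates, and bounded fourth
moments of the coordinates of `x xᵀ` along the targets. -/
def MomentAssumption {p N : ℕ → ℕ} (ν : ∀ n, Measure (Fin (p n) → ℝ))
    (G : ∀ n, Matrix (Fin (p n)) (Fin (p n)) ℝ)
    (T : ∀ n, Fin (N n) → Matrix (Fin (p n)) (Fin (p n)) ℝ) : Prop :=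
  ∃ K₂ : ℝ, ∀ n : ℕ, 1 ≤ n →
    (∀ i, Integrable (fun x => ((G n)ᵀ *ᵥ x) i ^ 8) (ν n)) ∧
    1 / (p n : ℝ) * ∑ i, ∫ x, ((G n)ᵀ *ᵥ x) i ^ 8 ∂(ν n) ≤ K₂ ∧
    ∀ k, Integrable (fun x => inner (Matrix.vecMulVec x x) (T n k) ^ 4) (ν n) ∧
      ∫ x, inner (Matrix.vecMulVec x x) (T n k) ^ 4 ∂(ν n) ≤ K₂

/-- The number of targets is negligible compared to the sample size. -/
def TargetCountAssumption (N : ℕ → ℕ) : Prop :=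
  (fun n => (N n : ℝ)) =o[atTop] (fun n : ℕ => (n : ℝ))

/-- The `i`-th coordinate of `y = Gᵀ x`, minus its expectation. -/
def centeredCoord {p : ℕ} (ν : Measure (Fin p → ℝ)) (G : Matrix (Fin p) (Fin p) ℝ) (i : Fin p)
    (x : Fin p → ℝ) : ℝ :=
  (Gᵀ *ᵥ x) i - ∫ z, (Gᵀ *ᵥ z) i ∂ν

/-- `p² / n` times the average of `Cov(y_i y_j, y_k y_l)²`, with `y` centered, over all ordered
quadruples of distinct indices, tends to `0`. For `p < 4` there is no such quadruple and the
average is read as `0`. -/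
def CovarianceAssumption {p : ℕ → ℕ} (ν : ∀ n, Measure (Fin (p n) → ℝ))
    (G : ∀ n, Matrix (Fin (p n)) (Fin (p n)) ℝ) : Prop :=
  Tendsto (fun n : ℕ => (p n : ℝ) ^ 2 / (n : ℝ) *
    ((∑ q : Fin 4 ↪ Fin (p n),
      cov[fun x => centeredCoord (ν n) (G n) (q 0) x * centeredCoord (ν n) (G n) (q 1) x,
        fun x => centeredCoord (ν n) (G n) (q 2) x * centeredCoord (ν n) (G n) (q 3) x;
        ν n] ^ 2)
      / (Fintype.card (Fin 4 ↪ Fin (p n)) : ℝ))) atTop (𝓝 0)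

/-- `V(S) = E ‖S - Σ‖²`. -/
def variance {Ω : Type*} [MeasurableSpace Ω] {p : ℕ} (P : Measure Ω)
    (S : Ω → Matrix (Fin p) (Fin p) ℝ) (A : Matrix (Fin p) (Fin p) ℝ) : ℝ :=
  ∫ ω, norm (S ω - A) ^ 2 ∂P

/-- `V(⟨S, T⟩) = E ⟨S - Σ, T⟩²`. -/
def varianceTarget {Ω : Type*} [MeasurableSpace Ω] {p : ℕ} (P : Measure Ω)
    (S : Ω → Matrix (Fin p) (Fin p) ℝ) (A T : Matrix (Fin p) (Fin p) ℝ) : ℝ :=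
  ∫ ω, inner (S ω - A) T ^ 2 ∂P

/-- The random variable `est` is integrable with expectation `θ`. -/
def IsUnbiased {Ω : Type*} [MeasurableSpace Ω] (P : Measure Ω) (est : Ω → ℝ) (θ : ℝ) : Prop :=
  Integrable est P ∧ ∫ ω, est ω ∂P = θ

/-- `Z n` tends to `0` in quadratic mean (and is eventually square integrable). -/
def TendstoZeroQM {Ω : ℕ → Type*} [∀ n, MeasurableSpace (Ω n)] (P : ∀ n, Measure (Ω n))
    (Z : ∀ n, Ω n → ℝ) : Prop :=
  (∀ᶠ n in atTop, MemLp (Z n) 2 (P n)) ∧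
    Tendsto (fun n => ∫ ω, Z n ω ^ 2 ∂(P n)) atTop (𝓝 0)

end Shrinkage

end

/-! After subtracting the population mean, each estimator along a target `T` is a U-statistic: the
average, over all injective choices of m sample indices, of a kernel in m independent centered
vectors. For known mean m = 2 and the kernel is half a squared difference; for unknown mean m = 4
and the kernel only involves the differences z₀ - z₁ and z₂ - z₃ (`vhatTargetKnown_eq_average`,
`vhatTargetUnknown_eq_average`). The mean of the kernel and the variance of ⟨S, T⟩ are both
expressed through E T(x,x), E T(x,x)² and E T(x,y)², with x, y independent, and the two expressions
agree. This is unbiasedness.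

For consistency, a crude variance bound suffices. Kernels evaluated on disjoint index sets are
uncorrelated, and at most a fraction m²/n of the pairs of injections overlap, so a U-statistic with
kernel g has variance at most (m²/n) E g² (`integral_average_sub_sq_le`). It is applied once, to the
kernel summed over all targets. Bessel's inequality on rank-one matrices bounds that sum by a
constant times (1/(np)) ∑ |zᵢ|⁴, however many targets there are (`abs_sum_kernelKnown_le`,
`abs_sum_kernelUnknown_le`). Since E|x|⁸ = O(p⁴), the mean square error is O(p⁴/(n³p²)) =
O((p/n)²/n), which tends to zero.

The estimators of the variance of the whole matrix need no separate argument: the symmetrized matrix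
units form a Parseval frame of the symmetric matrices, and each whole-matrix estimator is the sum of
the target estimators over this frame (`vhatKnown_eq_sum`, `vhatUnknown_eq_sum`). The frame
satisfies Bessel's inequality, so the same bounds apply. -/

namespace UStat

/-! ### Subsamples of an i.i.d. sample. -/

section Measure

variable {E : Type*} [MeasurableSpace E] (ν : Measure E) [IsProbabilityMeasure ν]

theorem iIndepFun_eval {κ : Type*} [Fintype κ] :
    iIndepFun (fun (k : κ) (x : κ → E) => x k) (Measure.pi fun _ : κ => ν) :=
  iIndepFun_pi (μ := fun _ : κ => ν) (X := fun _ => id) fun _ => aemeasurable_id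

theorem measurePreserving_comp_injective {ι κ : Type*} [Fintype ι] [Fintype κ] {e : ι → κ}
    (he : Function.Injective e) :
    MeasurePreserving (fun (x : κ → E) (i : ι) => x (e i)) (Measure.pi fun _ : κ => ν)
      (Measure.pi fun _ : ι => ν) := by
  refine ⟨measurable_pi_lambda _ fun i => measurable_pi_apply _, ?_⟩
  have h := (iIndepFun_eval (κ := κ) ν).precomp he
  rw [iIndepFun_iff_map_fun_eq_pi_map fun i => (measurable_pi_apply (e i)).aemeasurable] at h
  refine h.trans ?_
  congr 1
  ext1 i
  exact (measurePreserving_eval (fun _ : κ => ν) (e i)).map_eq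

/-- Two injections with disjoint ranges glue to an injection of `ι ⊕ ι`, so the two subsamples are
jointly distributed as a product and Fubini splits the integral. -/
theorem integral_mul_of_disjoint {ι κ : Type*} [Fintype ι] [Fintype κ] {e f : ι → κ}
    (he : Function.Injective e) (hf : Function.Injective f) (hef : ∀ i j, e i ≠ f j)
    {g h : (ι → E) → ℝ} (hg : AEStronglyMeasurable g (Measure.pi fun _ => ν))
    (hh : AEStronglyMeasurable h (Measure.pi fun _ => ν)) :
    ∫ x, g (fun i => x (e i)) * h (fun i => x (f i)) ∂(Measure.pi fun _ : κ => ν)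
      = (∫ x, g x ∂(Measure.pi fun _ : ι => ν)) * ∫ x, h x ∂(Measure.pi fun _ : ι => ν) := by
  have hinj : Function.Injective (Sum.elim e f) := he.sumElim hf hef
  have h1 := measurePreserving_comp_injective ν hinj
  have h2 := (measurePreserving_sumPiEquivProdPi (fun _ : ι ⊕ ι => ν))
  have h3 := h2.comp h1
  rw [← integral_prod_mul, ← h3.map_eq, integral_map h3.measurable.aemeasurable]
  · rfl
  · rw [h3.map_eq]
    exact hg.comp_fst.mul hh.comp_snd

end Measure

/-! ### Counting overlapping injections. -/

section Count

/-- Composing with the transposition of `c` and `c'` exchanges the fibres of f ↦ f j over them, so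
all fibres have the same size. -/
theorem mul_card_embedding_apply_eq {ι κ : Type*} [Fintype ι] [Fintype κ] [DecidableEq ι]
    [DecidableEq κ] (j : ι) (c : κ) :
    Fintype.card κ * (Finset.univ.filter fun f : ι ↪ κ => f j = c).card
      = Fintype.card (ι ↪ κ) := by
  have h : ∀ c' : κ, (Finset.univ.filter fun f : ι ↪ κ => f j = c').card
      = (Finset.univ.filter fun f : ι ↪ κ => f j = c).card := by
    intro c'
    refine Finset.card_bij' (fun f _ => f.trans (Equiv.swap c c').toEmbedding)
      (fun f _ => f.trans (Equiv.swap c c').toEmbedding) ?_ ?_ ?_ ?_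
    · intro f hf
      simp only [Finset.mem_filter, Finset.mem_univ, true_and] at hf ⊢
      simp [hf]
    · intro f hf
      simp only [Finset.mem_filter, Finset.mem_univ, true_and] at hf ⊢
      simp [hf]
    · intro f _
      ext i
      simp
    · intro f _
      ext i
      simp
  have h' := Finset.card_eq_sum_card_fiberwise (f := fun f : ι ↪ κ => f j)
    (s := Finset.univ) (t := Finset.univ) (fun _ _ => by simp)
  rw [← Finset.card_univ (α := ι ↪ κ), h', Finset.sum_congr rfl fun c' _ => h c']
  simp

/-- Union bound over the pairs (i, j) with e i = f j, each of which has frequency 1 / |κ|. -/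
theorem mul_card_embedding_not_disjoint_le {ι κ : Type*} [Fintype ι] [Fintype κ] [DecidableEq ι]
    [DecidableEq κ] (e : ι ↪ κ) [DecidablePred fun f : ι ↪ κ => ∃ i j, e i = f j] :
    Fintype.card κ * (Finset.univ.filter fun f : ι ↪ κ => ∃ i j, e i = f j).card
      ≤ Fintype.card ι ^ 2 * Fintype.card (ι ↪ κ) := by
  have hsub : (Finset.univ.filter fun f : ι ↪ κ => ∃ i j, e i = f j) ⊆
      (Finset.univ : Finset (ι × ι)).biUnion
        fun q => Finset.univ.filter fun f : ι ↪ κ => f q.2 = e q.1 := by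
    intro f hf
    simp only [Finset.mem_filter, Finset.mem_univ, true_and, Finset.mem_biUnion] at hf ⊢
    obtain ⟨i, j, h⟩ := hf
    exact ⟨(i, j), h.symm⟩
  calc _ ≤ Fintype.card κ * ∑ q : ι × ι,
        (Finset.univ.filter fun f : ι ↪ κ => f q.2 = e q.1).card :=
        Nat.mul_le_mul_left _ ((Finset.card_le_card hsub).trans Finset.card_biUnion_le)
    _ = _ := by
        rw [Finset.mul_sum, Finset.sum_congr rfl fun q _ =>
          mul_card_embedding_apply_eq q.2 (e q.1)]
        simp [sq]

end Count

/-! ### Mean and variance of a U-statistic. -/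

section Main

variable {E : Type*} [MeasurableSpace E] (ν : Measure E) [IsProbabilityMeasure ν]

/-- The average of a kernel over all injective choices of its arguments in the sample. -/
noncomputable def average {m n : ℕ} (g : (Fin m → E) → ℝ) (x : Fin n → E) : ℝ :=
  (Fintype.card (Fin m ↪ Fin n) : ℝ)⁻¹ * ∑ e : Fin m ↪ Fin n, g fun i => x (e i)

variable {m n : ℕ} {g : (Fin m → E) → ℝ}

theorem memLp_average {q : ENNReal} (hg : MemLp g q (Measure.pi fun _ => ν)) :
    MemLp (average (n := n) g) q (Measure.pi fun _ => ν) := by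
  have h : MemLp (fun x : Fin n → E => ∑ e : Fin m ↪ Fin n, g fun i => x (e i)) q
      (Measure.pi fun _ => ν) := memLp_finsetSum _ fun e _ =>
    hg.comp_measurePreserving (measurePreserving_comp_injective ν e.injective)
  exact h.const_mul _

theorem card_embedding_pos (hmn : m ≤ n) : (0 : ℝ) < Fintype.card (Fin m ↪ Fin n) := by
  have : Nonempty (Fin m ↪ Fin n) := ⟨Fin.castLEEmb hmn⟩
  exact_mod_cast Fintype.card_pos

theorem integral_average (hmn : m ≤ n) (hg : Integrable g (Measure.pi fun _ => ν)) :
    ∫ x, average (n := n) g x ∂(Measure.pi fun _ => ν) = ∫ x, g x ∂(Measure.pi fun _ => ν) := by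
  unfold average
  have hmp := fun e : Fin m ↪ Fin n => measurePreserving_comp_injective (κ := Fin n) ν e.injective
  have h : ∀ e : Fin m ↪ Fin n, ∫ x : Fin n → E, g (fun i => x (e i)) ∂(Measure.pi fun _ => ν)
      = ∫ x, g x ∂(Measure.pi fun _ => ν) := by
    intro e
    rw [← (hmp e).map_eq, integral_map (hmp e).measurable.aemeasurable]
    rw [(hmp e).map_eq]
    exact hg.aestronglyMeasurable
  have hi : ∀ e : Fin m ↪ Fin n, Integrable (fun x : Fin n → E => g fun i => x (e i))
      (Measure.pi fun _ => ν) := fun e => (hmp e).integrable_comp_of_integrable hg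
  rw [integral_const_mul, integral_finsetSum _ fun e _ => hi e]
  simp only [h, Finset.sum_const, Finset.card_univ, nsmul_eq_mul]
  rw [← mul_assoc, inv_mul_cancel₀ (card_embedding_pos hmn).ne', one_mul]

/-- The variance of a U-statistic of fixed order is of the order of the inverse sample size. -/
theorem integral_average_sub_sq_le (hmn : m ≤ n) (hn : 1 ≤ n)
    (hg : MemLp g 2 (Measure.pi fun _ => ν)) :
    ∫ x, (average (n := n) g x - ∫ z, g z ∂(Measure.pi fun _ => ν)) ^ 2 ∂(Measure.pi fun _ => ν)
      ≤ (m : ℝ) ^ 2 / n * ∫ z, g z ^ 2 ∂(Measure.pi fun _ => ν) := by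
  classical
  set θ := ∫ z, g z ∂(Measure.pi fun _ => ν) with hθ
  set c : ℝ := (Fintype.card (Fin m ↪ Fin n) : ℝ) with hc
  have hc0 : 0 < c := card_embedding_pos hmn
  have hmp := fun e : Fin m ↪ Fin n => measurePreserving_comp_injective (κ := Fin n) ν e.injective
  have hgi : Integrable g (Measure.pi fun _ => ν) := hg.integrable (by norm_num)
  have hh : MemLp (fun z => g z - θ) 2 (Measure.pi fun _ => ν) := hg.sub (memLp_const θ)
  have hh0 : ∫ z, (g z - θ) ∂(Measure.pi fun _ => ν) = 0 := by
    rw [integral_sub hgi (integrable_const _)]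
    simp [hθ]
  have hcomp : ∀ e : Fin m ↪ Fin n, MemLp (fun x : Fin n → E => g (fun i => x (e i)) - θ) 2
      (Measure.pi fun _ => ν) := fun e => hh.comp_measurePreserving (hmp e)
  have hsq : ∀ e : Fin m ↪ Fin n, ∫ x : Fin n → E, (g (fun i => x (e i)) - θ) ^ 2
      ∂(Measure.pi fun _ => ν) = ∫ z, (g z - θ) ^ 2 ∂(Measure.pi fun _ => ν) := by
    intro e
    rw [← (hmp e).map_eq, integral_map (hmp e).measurable.aemeasurable]
    rw [(hmp e).map_eq]
    exact hh.integrable_sq.aestronglyMeasurable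
  set M := ∫ z, (g z - θ) ^ 2 ∂(Measure.pi fun _ => ν) with hM
  have hM0 : 0 ≤ M := integral_nonneg fun _ => sq_nonneg _
  -- Centering can only lower the second moment.
  have hMle : M ≤ ∫ z, g z ^ 2 ∂(Measure.pi fun _ => ν) := by
    have : M = ∫ z, g z ^ 2 ∂(Measure.pi fun _ => ν) - θ ^ 2 := by
      have e1 : ∀ z, (g z - θ) ^ 2 = g z ^ 2 - (2 * θ) * g z + θ ^ 2 := fun z => by ring
      simp only [hM, e1]
      have i1 : Integrable (fun z => g z ^ 2) (Measure.pi fun _ => ν) := hg.integrable_sq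
      have i2 : Integrable (fun z => 2 * θ * g z) (Measure.pi fun _ => ν) := hgi.const_mul _
      have i3 : Integrable (fun z => g z ^ 2 - 2 * θ * g z) (Measure.pi fun _ => ν) := i1.sub i2
      rw [integral_add i3 (integrable_const _), integral_sub i1 i2, integral_const_mul]
      simp [← hθ]
      ring
    nlinarith [sq_nonneg θ]
  -- Overlapping pairs are bounded by ab ≤ (a² + b²)/2; disjoint pairs factor into two vanishing
  -- means.
  have hcross : ∀ e f : Fin m ↪ Fin n, ∫ x : Fin n → E,
      (g (fun i => x (e i)) - θ) * (g (fun i => x (f i)) - θ) ∂(Measure.pi fun _ => ν)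
        ≤ if ∃ i j, e i = f j then M else 0 := by
    intro e f
    split_ifs with hef
    · calc _ ≤ ∫ x : Fin n → E, ((g (fun i => x (e i)) - θ) ^ 2 / 2
            + (g (fun i => x (f i)) - θ) ^ 2 / 2) ∂(Measure.pi fun _ => ν) := by
            refine integral_mono ((hcomp e).integrable_mul (hcomp f))
              (((hcomp e).integrable_sq.div_const 2).add ((hcomp f).integrable_sq.div_const 2))
              fun x => ?_
            have := sq_nonneg ((g (fun i => x (e i)) - θ) - (g (fun i => x (f i)) - θ))
            linarith
        _ = M := by
            rw [integral_add ((hcomp e).integrable_sq.div_const 2)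
              ((hcomp f).integrable_sq.div_const 2), integral_div, integral_div, hsq, hsq]
            ring
    · push Not at hef
      rw [integral_mul_of_disjoint ν e.injective f.injective hef hh.aestronglyMeasurable
        hh.aestronglyMeasurable, hh0]
      simp
  have hexp : ∀ x : Fin n → E, (average g x - θ) ^ 2 = (c⁻¹) ^ 2 *
      ∑ e : Fin m ↪ Fin n, ∑ f : Fin m ↪ Fin n,
        (g (fun i => x (e i)) - θ) * (g (fun i => x (f i)) - θ) := by
    intro x
    have : average g x - θ = c⁻¹ * ∑ e : Fin m ↪ Fin n, (g (fun i => x (e i)) - θ) := by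
      rw [Finset.sum_sub_distrib, mul_sub]
      simp only [average, Finset.sum_const, Finset.card_univ, nsmul_eq_mul, ← hc]
      rw [← mul_assoc c⁻¹ c, inv_mul_cancel₀ hc0.ne', one_mul]
    rw [this, mul_pow, sq (∑ e : Fin m ↪ Fin n, _), Finset.sum_mul_sum]
  have hn0 : (0 : ℝ) < n := by exact_mod_cast hn
  have hcount : ∀ e : Fin m ↪ Fin n,
      ((Finset.univ.filter fun f : Fin m ↪ Fin n => ∃ i j, e i = f j).card : ℝ)
        ≤ (m : ℝ) ^ 2 / n * c := by
    intro e
    have := mul_card_embedding_not_disjoint_le e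
    simp only [Fintype.card_fin] at this
    have h' : (n : ℝ) * ((Finset.univ.filter fun f : Fin m ↪ Fin n => ∃ i j, e i = f j).card : ℝ)
        ≤ (m : ℝ) ^ 2 * c := by rw [hc]; exact_mod_cast this
    rw [div_mul_eq_mul_div, le_div_iff₀ hn0]
    linarith
  have hint : ∀ e f : Fin m ↪ Fin n, Integrable (fun x : Fin n → E =>
      (g (fun i => x (e i)) - θ) * (g (fun i => x (f i)) - θ)) (Measure.pi fun _ => ν) :=
    fun e f => (hcomp e).integrable_mul (hcomp f)
  simp only [hexp]
  rw [integral_const_mul, integral_finsetSum _ fun e _ => integrable_finsetSum _ fun f _ =>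
    hint e f]
  calc _ ≤ (c⁻¹) ^ 2 * ∑ e : Fin m ↪ Fin n, (m : ℝ) ^ 2 / n * c * M := by
        gcongr with e _
        rw [integral_finsetSum _ fun f _ => hint e f]
        calc _ ≤ ∑ f : Fin m ↪ Fin n, if ∃ i j, e i = f j then M else 0 :=
              Finset.sum_le_sum fun f _ => hcross e f
          _ = ((Finset.univ.filter fun f : Fin m ↪ Fin n => ∃ i j, e i = f j).card : ℝ) * M := by
              rw [Finset.sum_ite]
              simp
          _ ≤ _ := by gcongr; exact hcount e
    _ = (m : ℝ) ^ 2 / n * M := by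
        simp only [Finset.sum_const, Finset.card_univ, nsmul_eq_mul, ← hc]
        field_simp
    _ ≤ _ := by gcongr

end Main

end UStat

namespace UStat

/-! ### Fourth order moments of bilinear forms in independent centered vectors. -/

section Moments

/-- The bilinear form of a matrix. -/
noncomputable def bilin {p : ℕ} (T : Matrix (Fin p) (Fin p) ℝ) (u v : Fin p → ℝ) : ℝ :=
  u ⬝ᵥ T *ᵥ v

variable {p : ℕ} {T : Matrix (Fin p) (Fin p) ℝ}

theorem bilin_eq_sum (T : Matrix (Fin p) (Fin p) ℝ) (u v : Fin p → ℝ) :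
    bilin T u v = ∑ i, ∑ j, T i j * (u i * v j) := by
  simp only [bilin, dotProduct, Matrix.mulVec, Finset.mul_sum]
  exact Finset.sum_congr rfl fun i _ => Finset.sum_congr rfl fun j _ => by ring

theorem bilin_comm (hT : T.IsSymm) (u v : Fin p → ℝ) : bilin T u v = bilin T v u := by
  rw [bilin_eq_sum, bilin_eq_sum, Finset.sum_comm]
  refine Finset.sum_congr rfl fun i _ => Finset.sum_congr rfl fun j _ => ?_
  rw [hT.apply i j]
  ring

theorem bilin_sub_left (u u' v : Fin p → ℝ) :
    bilin T (u - u') v = bilin T u v - bilin T u' v := by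
  simp [bilin, sub_dotProduct]

theorem bilin_sub_right (u v v' : Fin p → ℝ) :
    bilin T u (v - v') = bilin T u v - bilin T u v' := by
  simp [bilin, Matrix.mulVec_sub, dotProduct_sub]

theorem bilin_sum_smul {ι κ : Type*} [Fintype ι] [Fintype κ] (a : ι → ℝ) (b : κ → ℝ)
    (x : ι → Fin p → ℝ) (y : κ → Fin p → ℝ) :
    bilin T (∑ k, a k • x k) (∑ l, b l • y l) = ∑ k, ∑ l, a k * b l * bilin T (x k) (y l) := by
  simp only [bilin, Matrix.mulVec_sum, Matrix.mulVec_smul, sum_dotProduct, dotProduct_sum,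
    smul_dotProduct, dotProduct_smul, smul_eq_mul, Finset.mul_sum]
  rw [Finset.sum_comm]
  exact Finset.sum_congr rfl fun i _ => Finset.sum_congr rfl fun j _ => by ring

variable (ν : Measure (Fin p → ℝ)) [IsProbabilityMeasure ν] {κ : Type*} [Fintype κ]

theorem memLp_eval (hL : ∀ i, MemLp (fun x => x i) 4 ν) (k : κ) (i : Fin p) :
    MemLp (fun x : κ → Fin p → ℝ => x k i) 4 (Measure.pi fun _ => ν) :=
  (hL i).comp_measurePreserving (measurePreserving_eval (fun _ : κ => ν) k)

theorem memLp_bilin (hL : ∀ i, MemLp (fun x => x i) 4 ν) (k l : κ) :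
    MemLp (fun x : κ → Fin p → ℝ => bilin T (x k) (x l)) 2 (Measure.pi fun _ => ν) := by
  have : ENNReal.HolderTriple 4 4 2 := ⟨by
    rw [← two_mul, show (4 : ENNReal) = 2 * 2 by norm_num, ENNReal.mul_inv (by simp) (by simp),
      ← mul_assoc, ENNReal.mul_inv_cancel (by simp) (by simp), one_mul]⟩
  simp only [bilin_eq_sum]
  refine memLp_finsetSum _ fun i _ => memLp_finsetSum _ fun j _ => MemLp.const_mul ?_ _
  exact (memLp_eval ν hL l j).mul (memLp_eval ν hL k i)

/-- A term in which one index occurs only once has mean zero. -/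
theorem integral_bilin_mul_bilin_eq_zero (hL : ∀ i, MemLp (fun x => x i) 4 ν)
    (hmean : ∀ i, ∫ x, x i ∂ν = 0) {k l r s : κ} (hk : s ≠ k) (hl : s ≠ l) (hr : s ≠ r) :
    ∫ x : κ → Fin p → ℝ, bilin T (x k) (x l) * bilin T (x r) (x s)
      ∂(Measure.pi fun _ => ν) = 0 := by
  classical
  have hind := (iIndepFun_eval (κ := κ) ν).indepFun_finset {k, l, r} {s}
    (by simp [hk, hl, hr])
    fun i => measurable_pi_apply i
  -- The product is linear in `x s`, and the coefficients only involve the vectors k, l, r, which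
  -- are independent of it.
  have hsplit : ∀ x : κ → Fin p → ℝ, bilin T (x k) (x l) * bilin T (x r) (x s)
      = ∑ j, (bilin T (x k) (x l) * ∑ i, T i j * x r i) * x s j := by
    intro x
    rw [bilin_eq_sum T (x r), Finset.sum_comm, Finset.mul_sum]
    refine Finset.sum_congr rfl fun j _ => ?_
    rw [mul_assoc, Finset.sum_mul]
    congr 1
    exact Finset.sum_congr rfl fun i _ => by ring
  have hi : ∀ j, IndepFun
      (fun x : κ → Fin p → ℝ => bilin T (x k) (x l) * ∑ i, T i j * x r i)
      (fun x => x s j) (Measure.pi fun _ => ν) := by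
    intro j
    have hφ : Measurable fun z : (({k, l, r} : Finset κ) → Fin p → ℝ) =>
        bilin T (z ⟨k, by simp⟩) (z ⟨l, by simp⟩) * ∑ i, T i j * z ⟨r, by simp⟩ i := by
      simp only [bilin_eq_sum]
      fun_prop
    have hψ : Measurable fun z : (({s} : Finset κ) → Fin p → ℝ) => z ⟨s, by simp⟩ j := by
      fun_prop
    exact hind.comp hφ hψ
  have hi1 : ∀ j, Integrable
      (fun x : κ → Fin p → ℝ => bilin T (x k) (x l) * ∑ i, T i j * x r i)
      (Measure.pi fun _ => ν) := by
    intro j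
    have h2 : MemLp (fun x : κ → Fin p → ℝ => ∑ i, T i j * x r i) 2 (Measure.pi fun _ => ν) :=
      memLp_finsetSum _ fun i _ => MemLp.const_mul
        ((memLp_eval ν hL r i).mono_exponent (by norm_num)) _
    exact (memLp_bilin ν hL k l).integrable_mul h2
  have hi2 : ∀ j, Integrable (fun x : κ → Fin p → ℝ => x s j) (Measure.pi fun _ => ν) :=
    fun j => (memLp_eval ν hL s j).integrable (by norm_num)
  have hi3 : ∀ j, Integrable
      (fun x : κ → Fin p → ℝ => (bilin T (x k) (x l) * ∑ i, T i j * x r i) * x s j)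
      (Measure.pi fun _ => ν) := fun j => (hi j).integrable_mul (hi1 j) (hi2 j)
  simp only [hsplit]
  rw [integral_finsetSum _ fun j _ => hi3 j]
  refine Finset.sum_eq_zero fun j _ => ?_
  rw [(hi j).integral_fun_mul_eq_mul_integral (hi1 j).aestronglyMeasurable
    (hi2 j).aestronglyMeasurable]
  have : ∫ x : κ → Fin p → ℝ, x s j ∂(Measure.pi fun _ => ν) = ∫ x, x j ∂ν := by
    have hm := measurePreserving_eval (fun _ : κ => ν) s
    conv_rhs => rw [← hm.map_eq]
    rw [integral_map hm.measurable.aemeasurable (measurable_pi_apply j).aestronglyMeasurable]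
  rw [this, hmean j, mul_zero]

variable (T)

/-- `E T(x, x)`. -/
noncomputable def formMean : ℝ := ∫ x, bilin T x x ∂ν

/-- `E T(x, x)²`. -/
noncomputable def formSq : ℝ := ∫ x, bilin T x x ^ 2 ∂ν

/-- `E T(x, y)²` for independent `x` and `y`. -/
noncomputable def formCross : ℝ :=
  ∫ x : Fin 2 → Fin p → ℝ, bilin T (x 0) (x 1) ^ 2 ∂(Measure.pi fun _ => ν)

variable {T}

theorem measurable_bilin {α : Type*} [MeasurableSpace α] {f g : α → Fin p → ℝ}
    (hf : Measurable f) (hg : Measurable g) : Measurable fun x => bilin T (f x) (g x) := by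
  simp only [bilin_eq_sum]
  fun_prop

theorem integral_bilin_self (k : κ) :
    ∫ x : κ → Fin p → ℝ, bilin T (x k) (x k) ∂(Measure.pi fun _ => ν) = formMean T ν := by
  have hm := measurePreserving_eval (fun _ : κ => ν) k
  have hb : Measurable fun u : Fin p → ℝ => bilin T u u :=
    measurable_bilin measurable_id measurable_id
  rw [formMean]
  conv_rhs => rw [← hm.map_eq]
  rw [integral_map hm.measurable.aemeasurable hb.aestronglyMeasurable]

theorem integral_bilin_self_sq (k : κ) :
    ∫ x : κ → Fin p → ℝ, bilin T (x k) (x k) * bilin T (x k) (x k) ∂(Measure.pi fun _ => ν)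
      = formSq T ν := by
  have hm := measurePreserving_eval (fun _ : κ => ν) k
  have hb : Measurable fun u : Fin p → ℝ => bilin T u u :=
    measurable_bilin measurable_id measurable_id
  rw [formSq]
  conv_rhs => rw [← hm.map_eq]
  rw [integral_map hm.measurable.aemeasurable (hb.pow_const 2).aestronglyMeasurable]
  simp [sq]

theorem integral_bilin_cross_sq {k l : κ} (hkl : k ≠ l) :
    ∫ x : κ → Fin p → ℝ, bilin T (x k) (x l) * bilin T (x k) (x l) ∂(Measure.pi fun _ => ν)
      = formCross T ν := by
  have hinj : Function.Injective ![k, l] := by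
    intro i j
    fin_cases i <;> fin_cases j <;> simp [hkl, hkl.symm]
  have hm := measurePreserving_comp_injective ν hinj
  rw [formCross]
  conv_rhs => rw [← hm.map_eq]
  rw [integral_map hm.measurable.aemeasurable
    ((measurable_bilin (measurable_pi_apply _) (measurable_pi_apply _)).pow_const
      2).aestronglyMeasurable]
  simp [sq]

theorem integral_bilin_self_mul_self {k r : κ} (hkr : k ≠ r) :
    ∫ x : κ → Fin p → ℝ, bilin T (x k) (x k) * bilin T (x r) (x r) ∂(Measure.pi fun _ => ν)
      = formMean T ν ^ 2 := by
  have hb : Measurable fun u : Fin p → ℝ => bilin T u u :=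
    measurable_bilin measurable_id measurable_id
  have hind := ((iIndepFun_eval (κ := κ) ν).indepFun hkr).comp hb hb
  have := hind.integral_mul_eq_mul_integral
    (hb.comp (measurable_pi_apply k)).aestronglyMeasurable
    (hb.comp (measurable_pi_apply r)).aestronglyMeasurable
  rw [sq]
  nth_rewrite 1 [← integral_bilin_self ν k]
  rw [← integral_bilin_self ν r]
  exact this

/-- Only index patterns in which no index stands alone contribute: the three pairings, or all four
indices equal. At four equal indices the three pairings together give `formMean ^ 2 + 2 *
formCross`, and the last term corrects this to `formSq`. Indicators make the formula ready to be
summed against coefficients. -/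
theorem integral_bilin_mul_bilin [DecidableEq κ] (hT : T.IsSymm)
    (hL : ∀ i, MemLp (fun x => x i) 4 ν) (hmean : ∀ i, ∫ x, x i ∂ν = 0) (k l r s : κ) :
    ∫ x : κ → Fin p → ℝ, bilin T (x k) (x l) * bilin T (x r) (x s) ∂(Measure.pi fun _ => ν)
      = formMean T ν ^ 2 * ((if k = l then 1 else 0) * (if r = s then 1 else 0))
        + formCross T ν * ((if k = r then 1 else 0) * (if l = s then 1 else 0)
          + (if k = s then 1 else 0) * (if l = r then 1 else 0))
        + (formSq T ν - formMean T ν ^ 2 - 2 * formCross T ν)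
          * ((if k = l then 1 else 0) * (if k = r then 1 else 0) * (if k = s then 1 else 0)) := by
  have z : ∀ {k l r s : κ}, s ≠ k → s ≠ l → s ≠ r → ∫ x : κ → Fin p → ℝ,
      bilin T (x k) (x l) * bilin T (x r) (x s) ∂(Measure.pi fun _ => ν) = 0 :=
    fun h1 h2 h3 => integral_bilin_mul_bilin_eq_zero ν hL hmean h1 h2 h3
  by_cases hkl : k = l
  · subst hkl
    by_cases hrs : r = s
    · subst hrs
      by_cases hkr : k = r
      · subst hkr
        rw [integral_bilin_self_sq]
        simp
        ring
      · rw [integral_bilin_self_mul_self ν hkr]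
        simp [hkr]
    · by_cases hkr : k = r
      · subst hkr
        rw [z (Ne.symm hrs) (Ne.symm hrs) (Ne.symm hrs)]
        simp [hrs]
      · rw [show (fun x : κ → Fin p → ℝ => bilin T (x k) (x k) * bilin T (x r) (x s))
          = fun x => bilin T (x k) (x k) * bilin T (x s) (x r) from by
            ext x; rw [bilin_comm hT (x r)], z (Ne.symm hkr) (Ne.symm hkr) hrs]
        simp [hrs, hkr]
  · by_cases h1 : k = r ∧ l = s
    · obtain ⟨rfl, rfl⟩ := h1
      rw [integral_bilin_cross_sq ν hkl]
      simp [hkl, Ne.symm hkl]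
    · by_cases h2 : k = s ∧ l = r
      · obtain ⟨rfl, rfl⟩ := h2
        rw [show (fun x : κ → Fin p → ℝ => bilin T (x k) (x l) * bilin T (x l) (x k))
          = fun x => bilin T (x k) (x l) * bilin T (x k) (x l) from by
            ext x; rw [bilin_comm hT (x l)], integral_bilin_cross_sq ν hkl]
        simp [hkl, Ne.symm hkl]
      · have hzero : ∫ x : κ → Fin p → ℝ, bilin T (x k) (x l) * bilin T (x r) (x s)
            ∂(Measure.pi fun _ => ν) = 0 := by
          -- If `k` is matched in the other factor, then `l` stands alone; otherwise `k` does. The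
          -- lone index is moved to the last slot by commuting the factors and using the symmetry of
          -- `T`.
          by_cases hk : k = r ∨ k = s
          · have hlr : l ≠ r := by grind
            have hls : l ≠ s := by grind
            rw [show (fun x : κ → Fin p → ℝ => bilin T (x k) (x l) * bilin T (x r) (x s))
              = fun x => bilin T (x r) (x s) * bilin T (x k) (x l) from by
                ext x; rw [mul_comm]]
            exact z hlr hls (Ne.symm hkl)
          · push Not at hk
            rw [show (fun x : κ → Fin p → ℝ => bilin T (x k) (x l) * bilin T (x r) (x s))
              = fun x => bilin T (x r) (x s) * bilin T (x l) (x k) from by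
                ext x; rw [mul_comm, bilin_comm hT (x k)]]
            exact z hk.1 hk.2 hkl
        rw [hzero]
        simp only [hkl, if_false]
        grind

/-- The fourth order moments of linear combinations of independent centered vectors. -/
theorem integral_bilin_comb_mul (hT : T.IsSymm) (hL : ∀ i, MemLp (fun x => x i) 4 ν)
    (hmean : ∀ i, ∫ x, x i ∂ν = 0) (a b c d : κ → ℝ) :
    ∫ x : κ → Fin p → ℝ, bilin T (∑ k, a k • x k) (∑ k, b k • x k)
        * bilin T (∑ k, c k • x k) (∑ k, d k • x k) ∂(Measure.pi fun _ => ν)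
      = formMean T ν ^ 2 * ((∑ k, a k * b k) * ∑ k, c k * d k)
        + formCross T ν * ((∑ k, a k * c k) * (∑ k, b k * d k)
          + (∑ k, a k * d k) * ∑ k, b k * c k)
        + (formSq T ν - formMean T ν ^ 2 - 2 * formCross T ν) * ∑ k, a k * b k * c k * d k := by
  classical
  have hexp : ∀ x : κ → Fin p → ℝ, bilin T (∑ k, a k • x k) (∑ k, b k • x k)
        * bilin T (∑ k, c k • x k) (∑ k, d k • x k)
      = ∑ k, ∑ l, ∑ r, ∑ s, (a k * b l * (c r * d s)) *
          (bilin T (x k) (x l) * bilin T (x r) (x s)) := by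
    intro x
    rw [bilin_sum_smul, bilin_sum_smul, Finset.sum_mul]
    refine Finset.sum_congr rfl fun k _ => ?_
    rw [Finset.sum_mul]
    refine Finset.sum_congr rfl fun l _ => ?_
    rw [Finset.mul_sum]
    refine Finset.sum_congr rfl fun r _ => ?_
    rw [Finset.mul_sum]
    exact Finset.sum_congr rfl fun s _ => by ring
  have hint : ∀ k l r s : κ, Integrable (fun x : κ → Fin p → ℝ => (a k * b l * (c r * d s)) *
          (bilin T (x k) (x l) * bilin T (x r) (x s))) (Measure.pi fun _ => ν) :=
    fun k l r s => Integrable.const_mul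
      ((memLp_bilin ν hL k l).integrable_mul (memLp_bilin ν hL r s)) _
  simp only [hexp]
  rw [integral_finsetSum _ fun k _ => integrable_finsetSum _ fun l _ =>
    integrable_finsetSum _ fun r _ => integrable_finsetSum _ fun s _ => hint k l r s]
  simp_rw [integral_finsetSum _ fun l _ => integrable_finsetSum _ fun r _ =>
    integrable_finsetSum _ fun s _ => hint _ l r s]
  simp_rw [integral_finsetSum _ fun r _ => integrable_finsetSum _ fun s _ => hint _ _ r s]
  simp_rw [integral_finsetSum _ fun s _ => hint _ _ _ s]
  simp only [integral_const_mul, integral_bilin_mul_bilin ν hT hL hmean]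
  simp only [mul_add, Finset.sum_add_distrib, mul_ite, mul_one, mul_zero,
    Finset.sum_ite_eq, Finset.mem_univ, if_true, Finset.sum_const_zero, Finset.sum_ite_irrel]
  simp only [Finset.sum_mul_sum]
  rw [mul_comm (formMean T ν ^ 2), mul_comm (formCross T ν), mul_comm (formCross T ν),
    mul_comm (formSq T ν - _ - _)]
  simp only [Finset.sum_mul]
  refine congrArg₂ _ (congrArg₂ _ ?_ (congrArg₂ _ ?_ ?_)) ?_
  · rfl
  · exact Finset.sum_congr rfl fun k _ => Finset.sum_congr rfl fun l _ => by ring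
  · exact Finset.sum_congr rfl fun k _ => Finset.sum_congr rfl fun l _ => by ring
  · exact Finset.sum_congr rfl fun k _ => by ring

end Moments

end UStat

namespace UStat

/-! ### Sums over tuples of distinct indices. -/

section Distinct

theorem sum_embedding_eq_sum_ite {m : ℕ} {α : Type*} [Fintype α] [DecidableEq α]
    (F : (Fin m → α) → ℝ) :
    ∑ e : Fin m ↪ α, F e = ∑ f : Fin m → α, if Function.Injective f then F f else 0 := by
  rw [← Finset.sum_filter, Finset.sum_subtype (Finset.univ.filter Function.Injective)
    (p := Function.Injective) (by simp) F]
  exact (Fintype.sum_equiv (Equiv.subtypeInjectiveEquivEmbedding (Fin m) α) _ _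
    fun _ => rfl).symm

theorem sum_pi_fin_succ {m : ℕ} {α : Type*} [Fintype α] (F : (Fin (m + 1) → α) → ℝ) :
    ∑ f : Fin (m + 1) → α, F f = ∑ a, ∑ f : Fin m → α, F (Fin.cons a f) := by
  rw [← Fintype.sum_prod_type' (f := fun a f => F (Fin.cons a f))]
  exact (Fintype.sum_equiv (Fin.consEquiv fun _ => α) _ _ fun _ => rfl).symm

theorem sum_embedding_two {α : Type*} [Fintype α] [DecidableEq α] (g : α → α → ℝ) :
    ∑ e : Fin 2 ↪ α, g (e 0) (e 1) = ∑ k, ∑ l, if k ≠ l then g k l else 0 := by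
  rw [sum_embedding_eq_sum_ite fun f => g (f 0) (f 1)]
  simp only [sum_pi_fin_succ, Finset.univ_unique, Finset.sum_singleton]
  refine Finset.sum_congr rfl fun k _ => Finset.sum_congr rfl fun l _ => ?_
  congr 1
  simp [Fin.cons_injective_iff, Function.injective_of_subsingleton]

theorem sum_ite_ne_ne {α : Type*} [Fintype α] [DecidableEq α] {k l : α} (hkl : k ≠ l)
    (G : α → ℝ) :
    ∑ r, (if r ≠ k ∧ r ≠ l then G r else 0) = ∑ r, G r - G k - G l := by
  have h : ∀ r, (if r ≠ k ∧ r ≠ l then G r else 0)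
      = G r - (if r = k then G r else 0) - (if r = l then G r else 0) := by
    intro r
    grind
  simp [h, Finset.sum_sub_distrib]

theorem sum_ite_ne_ne_ne {α : Type*} [Fintype α] [DecidableEq α] {k l r : α} (hkl : k ≠ l)
    (hrk : r ≠ k) (hrl : r ≠ l) (G : α → ℝ) :
    ∑ s, (if s ≠ k ∧ s ≠ l ∧ s ≠ r then G s else 0) = ∑ s, G s - G k - G l - G r := by
  have h : ∀ s, (if s ≠ k ∧ s ≠ l ∧ s ≠ r then G s else 0)
      = G s - (if s = k then G s else 0) - (if s = l then G s else 0)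
        - (if s = r then G s else 0) := by
    intro s
    grind
  simp [h, Finset.sum_sub_distrib]

/-- Sums over quadruples of distinct indices, the last two being summed freely first. -/
theorem sum_embedding_four {α : Type*} [Fintype α] [DecidableEq α] (g : α → α → α → α → ℝ) :
    ∑ e : Fin 4 ↪ α, g (e 0) (e 1) (e 2) (e 3) = ∑ k, ∑ l, if k ≠ l then
      (∑ r, (∑ s, g k l r s - g k l r k - g k l r l - g k l r r))
      - (∑ s, g k l k s - g k l k k - g k l k l - g k l k k)
      - (∑ s, g k l l s - g k l l k - g k l l l - g k l l l) else 0 := by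
  rw [sum_embedding_eq_sum_ite fun f => g (f 0) (f 1) (f 2) (f 3)]
  simp only [sum_pi_fin_succ, Finset.univ_unique, Finset.sum_singleton]
  refine Finset.sum_congr rfl fun k _ => Finset.sum_congr rfl fun l _ => ?_
  by_cases hkl : k = l
  · subst hkl
    have : ∀ r s, ¬ Function.Injective
        (Fin.cons k (Fin.cons k (Fin.cons r (Fin.cons s default))) : Fin 4 → α) := by
      intro r s h
      have := @h 0 1 rfl
      simp at this
    simp [this]
  · have hinj : ∀ r s, Function.Injective
        (Fin.cons k (Fin.cons l (Fin.cons r (Fin.cons s default))) : Fin 4 → α) ↔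
        (r ≠ k ∧ r ≠ l) ∧ (s ≠ k ∧ s ≠ l ∧ s ≠ r) := by
      intro r s
      simp only [Fin.cons_injective_iff, Function.injective_of_subsingleton, and_true,
        Set.mem_range, Fin.exists_fin_succ]
      have h2 : (Fin.cons l (Fin.cons r (Fin.cons s default)) : Fin 3 → α) 2 = s := rfl
      simp [h2]
      grind
    have h1 : ∀ r, (∑ s, if Function.Injective
        (Fin.cons k (Fin.cons l (Fin.cons r (Fin.cons s default))) : Fin 4 → α) then
          g k l r s else 0) = if r ≠ k ∧ r ≠ l then
        (∑ s, g k l r s - g k l r k - g k l r l - g k l r r) else 0 := by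
      intro r
      simp only [hinj]
      by_cases hr : r ≠ k ∧ r ≠ l
      · simp only [hr, if_true, ← sum_ite_ne_ne_ne hkl hr.1 hr.2, true_and, ne_eq,
          not_false_eq_true]
      · simp [hr]
    rw [if_pos hkl, ← sum_ite_ne_ne hkl
      fun r => (∑ s, g k l r s - g k l r k - g k l r l - g k l r r)]
    exact Finset.sum_congr rfl fun r _ => h1 r

end Distinct

/-! ### Three kernel sums for a symmetric matrix with zero row sums. -/

section MatrixSums

variable {n : ℕ}

/-- Vanishing row sums kill the products of a diagonal entry with `s k l`, so only ∑ s_kk², (∑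
s_kk)², ∑∑ s_kl² and a linear term remain. The linear term serves for coefficients that themselves
contain the trace ∑ s_tt. Later `s` is the Gram matrix of the deviations from the empirical mean. -/
theorem sum_quadratic (s : Fin n → Fin n → ℝ) (hsymm : ∀ k l, s k l = s l k)
    (hrow : ∀ k, ∑ l, s k l = 0) (c₁ c₂ c₃ c₄ c₅ c₆ c₇ c₈ : ℝ) :
    ∑ k, ∑ l, (c₁ * s k k ^ 2 + c₂ * s l l ^ 2 + c₃ * (s k k * s l l) + c₄ * (s k k * s k l)
      + c₅ * (s l l * s k l) + c₆ * s k l ^ 2 + c₇ * s k k + c₈ * s l l)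
    = n * (c₁ + c₂) * ∑ k, s k k ^ 2 + c₃ * (∑ k, s k k) ^ 2 + c₆ * ∑ k, ∑ l, s k l ^ 2
      + n * (c₇ + c₈) * ∑ k, s k k := by
  have h4 : ∑ k, ∑ l, c₄ * (s k k * s k l) = 0 := by
    simp only [← Finset.mul_sum, hrow, mul_zero, Finset.sum_const_zero]
  have h5 : ∑ k, ∑ l, c₅ * (s l l * s k l) = 0 := by
    rw [Finset.sum_comm]
    refine Finset.sum_eq_zero fun l _ => ?_
    simp only [← Finset.mul_sum]
    have : ∑ k, s k l = 0 := by simpa only [hsymm _ l] using hrow l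
    rw [this, mul_zero, mul_zero]
  simp only [Finset.sum_add_distrib, h4, h5]
  simp only [← Finset.mul_sum, Finset.sum_const, Finset.card_univ, Fintype.card_fin, nsmul_eq_mul,
    sq (∑ k, s k k), Finset.sum_mul]
  ring

theorem sum_sq_sub (u : Fin n → ℝ) (hu : ∑ r, u r = 0) (a : ℝ) :
    ∑ r, (u r - a) ^ 2 = ∑ r, u r ^ 2 + n * a ^ 2 := by
  have h : ∀ r, (u r - a) ^ 2 = u r ^ 2 - (2 * a) * u r + a ^ 2 := fun r => by ring
  simp [h, Finset.sum_add_distrib, Finset.sum_sub_distrib, ← Finset.mul_sum, hu]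

/-- The summand ignores the last two indices, which contribute the factor (n - 2)(n - 3). It
vanishes at k = l, so the sum over k, l becomes unrestricted. -/
theorem sum_embedding_distance_sq (s : Fin n → Fin n → ℝ) (hsymm : ∀ k l, s k l = s l k)
    (hrow : ∀ k, ∑ l, s k l = 0) :
    ∑ e : Fin 4 ↪ Fin n, (s (e 0) (e 0) - 2 * s (e 0) (e 1) + s (e 1) (e 1)) ^ 2
      = (n - 2) * (n - 3) * (2 * n * ∑ k, s k k ^ 2 + 2 * (∑ k, s k k) ^ 2
        + 4 * ∑ k, ∑ l, s k l ^ 2) := by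
  rw [sum_embedding_four fun k l _ _ => (s k k - 2 * s k l + s l l) ^ 2]
  have h : ∀ k l, (if k ≠ l then
      (∑ r : Fin n, (∑ _s : Fin n, (s k k - 2 * s k l + s l l) ^ 2 - (s k k - 2 * s k l + s l l) ^ 2
        - (s k k - 2 * s k l + s l l) ^ 2 - (s k k - 2 * s k l + s l l) ^ 2))
      - (∑ _s : Fin n, (s k k - 2 * s k l + s l l) ^ 2 - (s k k - 2 * s k l + s l l) ^ 2
        - (s k k - 2 * s k l + s l l) ^ 2 - (s k k - 2 * s k l + s l l) ^ 2)
      - (∑ _s : Fin n, (s k k - 2 * s k l + s l l) ^ 2 - (s k k - 2 * s k l + s l l) ^ 2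
        - (s k k - 2 * s k l + s l l) ^ 2 - (s k k - 2 * s k l + s l l) ^ 2) else 0)
      = (n - 2) * (n - 3) * (1 * s k k ^ 2 + 1 * s l l ^ 2 + 2 * (s k k * s l l)
        + (-4) * (s k k * s k l) + (-4) * (s l l * s k l) + 4 * s k l ^ 2 + 0 * s k k
        + 0 * s l l) := by
    intro k l
    by_cases hkl : k = l
    · subst hkl
      simp only [ne_eq, not_true_eq_false, if_false]
      ring
    · simp only [ne_eq, hkl, not_false_eq_true, if_true, Finset.sum_const, Finset.card_univ,
        Fintype.card_fin, nsmul_eq_mul]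
      ring
  simp only [h, ← Finset.mul_sum]
  rw [sum_quadratic s hsymm hrow]
  ring

theorem sum_embedding_distance_mul (s : Fin n → Fin n → ℝ) (hsymm : ∀ k l, s k l = s l k)
    (hrow : ∀ k, ∑ l, s k l = 0) :
    ∑ e : Fin 4 ↪ Fin n, (s (e 0) (e 0) - 2 * s (e 0) (e 1) + s (e 1) (e 1))
        * (s (e 2) (e 2) - 2 * s (e 2) (e 3) + s (e 3) (e 3))
      = (4 * n ^ 2 - 12 * n + 4) * (∑ k, s k k) ^ 2 - (4 * n ^ 2 - 4 * n) * ∑ k, s k k ^ 2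
        + 8 * ∑ k, ∑ l, s k l ^ 2 := by
  rw [sum_embedding_four fun k l r t => (s k k - 2 * s k l + s l l) * (s r r - 2 * s r t + s t t)]
  have h1 : ∀ r, ∑ t, (s r r - 2 * s r t + s t t) = n * s r r + ∑ t, s t t := by
    intro r
    simp [Finset.sum_add_distrib, Finset.sum_sub_distrib, ← Finset.mul_sum, hrow]
  have h2 : ∀ k, ∑ r, s r k = 0 := fun k => by simpa only [hsymm _ k] using hrow k
  -- The sum over the two free indices, less the terms meeting k or l. The factor `s k k - 2 * s k l
  -- + s l l` makes the result correct at k = l too.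
  have h : ∀ k l, (if k ≠ l then
      (∑ r : Fin n, (∑ t : Fin n, (s k k - 2 * s k l + s l l) * (s r r - 2 * s r t + s t t)
          - (s k k - 2 * s k l + s l l) * (s r r - 2 * s r k + s k k)
          - (s k k - 2 * s k l + s l l) * (s r r - 2 * s r l + s l l)
          - (s k k - 2 * s k l + s l l) * (s r r - 2 * s r r + s r r)))
      - (∑ t : Fin n, (s k k - 2 * s k l + s l l) * (s k k - 2 * s k t + s t t)
          - (s k k - 2 * s k l + s l l) * (s k k - 2 * s k k + s k k)
          - (s k k - 2 * s k l + s l l) * (s k k - 2 * s k l + s l l)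
          - (s k k - 2 * s k l + s l l) * (s k k - 2 * s k k + s k k))
      - (∑ t : Fin n, (s k k - 2 * s k l + s l l) * (s l l - 2 * s l t + s t t)
          - (s k k - 2 * s k l + s l l) * (s l l - 2 * s l k + s k k)
          - (s k k - 2 * s k l + s l l) * (s l l - 2 * s l l + s l l)
          - (s k k - 2 * s k l + s l l) * (s l l - 2 * s l l + s l l)) else 0)
      = (s k k - 2 * s k l + s l l) * ((2 * n - 4) * ∑ t, s t t - 2 * n * (s k k + s l l)
          + 2 * (s k k - 2 * s k l + s l l)) := by
    intro k l
    by_cases hkl : k = l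
    · subst hkl
      simp only [ne_eq, not_true_eq_false, if_false]
      ring
    · simp only [ne_eq, hkl, not_false_eq_true, if_true, ← Finset.mul_sum,
        Finset.sum_sub_distrib, Finset.sum_add_distrib, hrow, h2, Finset.sum_const,
        Finset.card_univ, Fintype.card_fin, nsmul_eq_mul]
      rw [hsymm l k]
      ring
  have h' : ∀ k l, (s k k - 2 * s k l + s l l) * ((2 * n - 4) * ∑ t, s t t
        - 2 * n * (s k k + s l l) + 2 * (s k k - 2 * s k l + s l l))
      = (2 - 2 * n) * s k k ^ 2 + (2 - 2 * n) * s l l ^ 2 + (4 - 4 * n) * (s k k * s l l)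
        + (4 * n - 8) * (s k k * s k l) + (4 * n - 8) * (s l l * s k l) + 8 * s k l ^ 2
        + ((2 * n - 4) * ∑ t, s t t) * s k k + ((2 * n - 4) * ∑ t, s t t) * s l l
        - 2 * ((2 * n - 4) * ∑ t, s t t) * s k l := by
    intro k l
    ring
  rw [Finset.sum_congr rfl fun k _ => Finset.sum_congr rfl fun l _ => (h k l).trans (h' k l)]
  simp only [Finset.sum_sub_distrib]
  rw [sum_quadratic s hsymm hrow]
  simp only [← Finset.mul_sum, hrow, Finset.sum_const_zero]
  ring

/-- For fixed k, l the summand is (u_r - u_t)² with u = s_k - s_l, a vector of sum zero, so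
`sum_sq_sub` performs the inner sums. At k = l one has u = 0 and the restriction k ≠ l can be
dropped. -/
theorem sum_embedding_cross_sq (s : Fin n → Fin n → ℝ) (hsymm : ∀ k l, s k l = s l k)
    (hrow : ∀ k, ∑ l, s k l = 0) :
    ∑ e : Fin 4 ↪ Fin n, (s (e 0) (e 2) - s (e 0) (e 3) - (s (e 1) (e 2) - s (e 1) (e 3))) ^ 2
      = 4 * (n - 1) * (n - 2) * ∑ k, ∑ l, s k l ^ 2 - 4 * n * (n - 1) * ∑ k, s k k ^ 2
        + 4 * (∑ k, s k k) ^ 2 := by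
  rw [sum_embedding_four fun k l r t => (s k r - s k t - (s l r - s l t)) ^ 2]
  have hu : ∀ k l, ∑ t, (s k t - s l t) = 0 := by simp [Finset.sum_sub_distrib, hrow]
  have h1 : ∀ k l r, ∑ t, (s k r - s k t - (s l r - s l t)) ^ 2
      = ∑ t, (s k t - s l t) ^ 2 + n * (s k r - s l r) ^ 2 := by
    intro k l r
    rw [← sum_sq_sub _ (hu k l)]
    exact Finset.sum_congr rfl fun t _ => by ring
  have h2 : ∀ k l t, ∑ r, (s k r - s k t - (s l r - s l t)) ^ 2
      = ∑ t, (s k t - s l t) ^ 2 + n * (s k t - s l t) ^ 2 := by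
    intro k l t
    rw [← sum_sq_sub _ (hu k l)]
    exact Finset.sum_congr rfl fun t _ => by ring
  have h : ∀ k l, (if k ≠ l then
      (∑ r, (∑ t, (s k r - s k t - (s l r - s l t)) ^ 2
        - (s k r - s k k - (s l r - s l k)) ^ 2
        - (s k r - s k l - (s l r - s l l)) ^ 2
        - (s k r - s k r - (s l r - s l r)) ^ 2))
      - (∑ t, (s k k - s k t - (s l k - s l t)) ^ 2
        - (s k k - s k k - (s l k - s l k)) ^ 2
        - (s k k - s k l - (s l k - s l l)) ^ 2
        - (s k k - s k k - (s l k - s l k)) ^ 2)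
      - (∑ t, (s k l - s k t - (s l l - s l t)) ^ 2
        - (s k l - s k k - (s l l - s l k)) ^ 2
        - (s k l - s k l - (s l l - s l l)) ^ 2
        - (s k l - s k l - (s l l - s l l)) ^ 2) else 0)
      = (2 * n - 4) * ∑ t, (s k t - s l t) ^ 2 - 2 * n * ((s k k - s k l) ^ 2 + (s k l - s l l) ^ 2)
        + 2 * (s k k - 2 * s k l + s l l) ^ 2 := by
    intro k l
    by_cases hkl : k = l
    · subst hkl
      simp only [ne_eq, not_true_eq_false, if_false, sub_self]
      simp
      ring
    · simp only [ne_eq, hkl, not_false_eq_true, if_true, Finset.sum_sub_distrib]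
      simp only [h1, h2, Finset.sum_add_distrib, ← Finset.mul_sum, Finset.sum_const,
        Finset.card_univ, Fintype.card_fin, nsmul_eq_mul, sub_self]
      rw [hsymm l k]
      ring
  -- The cross terms vanish because the columns of `s` sum to zero.
  have h3 : ∑ k, ∑ l, ∑ t, (s k t - s l t) ^ 2 = 2 * n * ∑ k, ∑ l, s k l ^ 2 := by
    have e1 : ∀ k l, ∑ t, (s k t - s l t) ^ 2 = ∑ t, s k t ^ 2 + ∑ t, s l t ^ 2
        - 2 * ∑ t, s k t * s l t := by
      intro k l
      rw [Finset.mul_sum, ← Finset.sum_add_distrib, ← Finset.sum_sub_distrib]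
      exact Finset.sum_congr rfl fun t _ => by ring
    have e2 : ∀ k, ∑ l, ∑ t, s k t * s l t = 0 := by
      intro k
      rw [Finset.sum_comm]
      refine Finset.sum_eq_zero fun t _ => ?_
      have : ∑ l, s l t = 0 := by simpa only [hsymm _ t] using hrow t
      rw [← Finset.mul_sum, this, mul_zero]
    simp only [e1, Finset.sum_sub_distrib, Finset.sum_add_distrib, ← Finset.mul_sum, e2,
      Finset.sum_const, Finset.card_univ, Fintype.card_fin, nsmul_eq_mul]
    simp
    ring
  have h' : ∀ k l, (2 * n - 4) * ∑ t, (s k t - s l t) ^ 2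
        - 2 * n * ((s k k - s k l) ^ 2 + (s k l - s l l) ^ 2)
        + 2 * (s k k - 2 * s k l + s l l) ^ 2
      = (2 * n - 4) * ∑ t, (s k t - s l t) ^ 2
        + ((2 - 2 * n) * s k k ^ 2 + (2 - 2 * n) * s l l ^ 2 + 4 * (s k k * s l l)
        + (4 * n - 8) * (s k k * s k l) + (4 * n - 8) * (s l l * s k l) + (8 - 4 * n) * s k l ^ 2
        + 0 * s k k + 0 * s l l) := by
    intro k l
    ring
  rw [Finset.sum_congr rfl fun k _ => Finset.sum_congr rfl fun l _ => (h k l).trans (h' k l)]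
  simp only [Finset.sum_add_distrib (f := fun l => (2 * n - 4) * ∑ t, (s _ t - s l t) ^ 2)]
  rw [Finset.sum_add_distrib, sum_quadratic s hsymm hrow]
  simp only [← Finset.mul_sum, h3]
  ring

end MatrixSums

end UStat

namespace UStat

/-! ### The target estimators as U-statistics. -/

section Estimators

variable {p n : ℕ} {T : Matrix (Fin p) (Fin p) ℝ}

/-- The matrix whose columns are the given vectors. -/
def ofCols (x : Fin n → Fin p → ℝ) : Matrix (Fin p) (Fin n) ℝ :=
  Matrix.of fun i k => x k i

/-- The deviation of an observation from the empirical mean. -/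
noncomputable def deviation (x : Fin n → Fin p → ℝ) (k : Fin n) : Fin p → ℝ :=
  x k - (1 / (n : ℝ)) • ∑ l, x l

theorem deviation_sub (x : Fin n → Fin p → ℝ) (k l : Fin n) :
    deviation x k - deviation x l = x k - x l := by
  simp [deviation]

theorem sum_deviation (x : Fin n → Fin p → ℝ) : ∑ k, deviation x k = 0 := by
  rcases Nat.eq_zero_or_pos n with rfl | hn
  · simp
  · have : (n : ℝ) ≠ 0 := by positivity
    simp only [deviation, Finset.sum_sub_distrib, Finset.sum_const, Finset.card_univ,
      Fintype.card_fin, ← Nat.cast_smul_eq_nsmul ℝ, smul_smul]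
    simp [this]

theorem bilin_zero_right (u : Fin p → ℝ) : bilin T u 0 = 0 := by
  simp [bilin]

theorem sum_bilin_deviation (x : Fin n → Fin p → ℝ) (k : Fin n) :
    ∑ l, bilin T (deviation x k) (deviation x l) = 0 := by
  rw [← bilin_zero_right (T := T) (deviation x k), ← sum_deviation x]
  simp only [bilin, Matrix.mulVec_sum, dotProduct_sum]

theorem inner_eq_sum (A B : Matrix (Fin p) (Fin p) ℝ) :
    Shrinkage.inner A B = (∑ i, ∑ j, A i j * B i j) / p := by
  simp [Shrinkage.inner, Matrix.trace, Matrix.mul_apply]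

theorem norm_sq (A : Matrix (Fin p) (Fin p) ℝ) :
    Shrinkage.norm A ^ 2 = (∑ i, ∑ j, A i j ^ 2) / p := by
  rw [Shrinkage.norm, Real.sq_sqrt]
  · simp [Matrix.trace, Matrix.mul_apply, sq]
  · simp only [Matrix.trace, Matrix.diag_apply, Matrix.mul_apply, Matrix.transpose_apply]
    exact div_nonneg (Finset.sum_nonneg fun i _ => Finset.sum_nonneg fun j _ =>
      mul_self_nonneg _) (Nat.cast_nonneg _)

theorem inner_vecMulVec (u v : Fin p → ℝ) :
    Shrinkage.inner (Matrix.vecMulVec u v) T = bilin T u v / p := by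
  rw [inner_eq_sum, bilin_eq_sum]
  simp only [Matrix.vecMulVec_apply]
  congr 1
  exact Finset.sum_congr rfl fun i _ => Finset.sum_congr rfl fun j _ => by ring

theorem inner_sub_left (A B C : Matrix (Fin p) (Fin p) ℝ) :
    Shrinkage.inner (A - B) C = Shrinkage.inner A C - Shrinkage.inner B C := by
  simp [Shrinkage.inner, Matrix.sub_mul, sub_div]

theorem inner_smul_left (c : ℝ) (A B : Matrix (Fin p) (Fin p) ℝ) :
    Shrinkage.inner (c • A) B = c * Shrinkage.inner A B := by
  simp [Shrinkage.inner, mul_div_assoc]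

theorem inner_sum_left {ι : Type*} (s : Finset ι) (A : ι → Matrix (Fin p) (Fin p) ℝ)
    (B : Matrix (Fin p) (Fin p) ℝ) :
    Shrinkage.inner (∑ k ∈ s, A k) B = ∑ k ∈ s, Shrinkage.inner (A k) B := by
  simp [Shrinkage.inner, Matrix.sum_mul, Matrix.trace_sum, Finset.sum_div]

theorem ofCols_mul_transpose (x : Fin n → Fin p → ℝ) :
    ofCols x * (ofCols x)ᵀ = ∑ k, Matrix.vecMulVec (x k) (x k) := by
  ext i j
  simp [ofCols, Matrix.mul_apply, Matrix.sum_apply, Matrix.vecMulVec_apply]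

theorem outer_ofCols (x : Fin n → Fin p → ℝ) (k : Fin n) :
    Shrinkage.outer (ofCols x) k = Matrix.vecMulVec (x k) (x k) := rfl

theorem centerAt_zero (X : Matrix (Fin p) (Fin n) ℝ) : Shrinkage.centerAt 0 X = X := by
  ext i k
  simp [Shrinkage.centerAt]

theorem centerEmp_ofCols (x : Fin n → Fin p → ℝ) :
    Shrinkage.centerEmp (ofCols x) = ofCols (deviation x) := by
  ext i k
  simp [Shrinkage.centerEmp, ofCols, deviation]

theorem covKnown_ofCols (x : Fin n → Fin p → ℝ) :
    Shrinkage.covKnown 0 (ofCols x) = (1 / (n : ℝ)) • ∑ k, Matrix.vecMulVec (x k) (x k) := by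
  rw [Shrinkage.covKnown, centerAt_zero, ofCols_mul_transpose]

theorem covUnknown_ofCols (x : Fin n → Fin p → ℝ) :
    Shrinkage.covUnknown (ofCols x)
      = (1 / ((n : ℝ) - 1)) • ∑ k, Matrix.vecMulVec (deviation x k) (deviation x k) := by
  rw [Shrinkage.covUnknown, centerEmp_ofCols, ofCols_mul_transpose]

theorem inner_covKnown_ofCols (x : Fin n → Fin p → ℝ) :
    Shrinkage.inner (Shrinkage.covKnown 0 (ofCols x)) T
      = 1 / (n : ℝ) * ((∑ k, bilin T (x k) (x k)) / p) := by
  rw [covKnown_ofCols, inner_smul_left, inner_sum_left, Finset.sum_div]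
  simp only [inner_vecMulVec]

theorem inner_covUnknown_ofCols (x : Fin n → Fin p → ℝ) :
    Shrinkage.inner (Shrinkage.covUnknown (ofCols x)) T
      = 1 / ((n : ℝ) - 1) * ((∑ k, bilin T (deviation x k) (deviation x k)) / p) := by
  rw [covUnknown_ofCols, inner_smul_left, inner_sum_left, Finset.sum_div]
  simp only [inner_vecMulVec]

theorem vecMulVec_mul_mul_vecMulVec (u v : Fin p → ℝ) :
    Matrix.vecMulVec u u * T * Matrix.vecMulVec v v = bilin T u v • Matrix.vecMulVec u v := by
  ext i j
  simp only [Matrix.mul_apply, Matrix.vecMulVec_apply, Matrix.smul_apply, smul_eq_mul,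
    bilin_eq_sum, Finset.sum_mul]
  rw [Finset.sum_comm]
  exact Finset.sum_congr rfl fun a _ => Finset.sum_congr rfl fun b _ => by ring

/-- Symmetry of S gives ⟨ST, TS⟩ = ⟨STS, T⟩, and a product (uuᵀ)T(vvᵀ) is T(u,v) uvᵀ; each pair of
deviations thus contributes T(u,v)². -/
theorem inner_covUnknown_mul_ofCols (x : Fin n → Fin p → ℝ) :
    Shrinkage.inner (Shrinkage.covUnknown (ofCols x) * T) (T * Shrinkage.covUnknown (ofCols x))
      = 1 / ((n : ℝ) - 1) ^ 2 *
        ((∑ k, ∑ l, bilin T (deviation x k) (deviation x l) ^ 2) / p) := by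
  have hsymm : (Shrinkage.covUnknown (ofCols x))ᵀ = Shrinkage.covUnknown (ofCols x) := by
    simp [Shrinkage.covUnknown]
  have h : Shrinkage.inner (Shrinkage.covUnknown (ofCols x) * T)
      (T * Shrinkage.covUnknown (ofCols x)) = Shrinkage.inner
        (Shrinkage.covUnknown (ofCols x) * T * Shrinkage.covUnknown (ofCols x)) T := by
    rw [Shrinkage.inner, Shrinkage.inner, Matrix.transpose_mul, hsymm, ← Matrix.mul_assoc]
  rw [h, covUnknown_ofCols]
  simp only [Matrix.smul_mul, Matrix.mul_smul, Matrix.sum_mul, Matrix.mul_sum, smul_smul,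
    vecMulVec_mul_mul_vecMulVec, inner_smul_left, inner_sum_left, inner_vecMulVec,
    Finset.smul_sum]
  rw [Finset.sum_comm, ← one_div_pow]
  simp only [Finset.sum_div, Finset.mul_sum]
  exact Finset.sum_congr rfl fun k _ => Finset.sum_congr rfl fun l _ => by ring

/-- The kernel of order two of the variance estimator, known mean. -/
noncomputable def kernelKnown (n : ℕ) (T : Matrix (Fin p) (Fin p) ℝ) (z : Fin 2 → Fin p → ℝ) : ℝ :=
  (bilin T (z 0) (z 0) - bilin T (z 1) (z 1)) ^ 2 / (2 * n * (p : ℝ) ^ 2)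

/-- The kernel of order four of the variance estimator, unknown mean. -/
noncomputable def kernelUnknown (n : ℕ) (T : Matrix (Fin p) (Fin p) ℝ)
    (z : Fin 4 → Fin p → ℝ) : ℝ :=
  (1 / (2 * n) * (bilin T (z 0 - z 1) (z 0 - z 1) ^ 2
      - bilin T (z 0 - z 1) (z 0 - z 1) * bilin T (z 2 - z 3) (z 2 - z 3))
    - (n - 2) / (2 * n * (n - 1)) * bilin T (z 0 - z 1) (z 2 - z 3) ^ 2) / (p : ℝ) ^ 2

theorem card_embedding_two (hn : 2 ≤ n) :
    (Fintype.card (Fin 2 ↪ Fin n) : ℝ) = n * (n - 1) := by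
  obtain ⟨m, rfl⟩ := Nat.exists_eq_add_of_le' hn
  rw [Fintype.card_embedding_eq]
  simp [Nat.descFactorial]
  ring

theorem card_embedding_four (hn : 4 ≤ n) :
    (Fintype.card (Fin 4 ↪ Fin n) : ℝ) = n * (n - 1) * (n - 2) * (n - 3) := by
  obtain ⟨m, rfl⟩ := Nat.exists_eq_add_of_le' hn
  rw [Fintype.card_embedding_eq]
  simp [Nat.descFactorial]
  ring

/-- The sample variance of the numbers T(x_k, x_k) is the average of half their squared pairwise
differences; a further 1/n passes to the variance of their mean. -/
theorem vhatTargetKnown_eq_average (hn : 2 ≤ n) (x : Fin n → Fin p → ℝ) :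
    Shrinkage.vhatTargetKnown 0 T (ofCols x) = average (kernelKnown n T) x := by
  have hn' : (2 : ℝ) ≤ n := by exact_mod_cast hn
  have hn0 : (n : ℝ) ≠ 0 := by positivity
  have hn1 : (n : ℝ) - 1 ≠ 0 := by linarith
  set a : Fin n → ℝ := fun k => bilin T (x k) (x k) with ha
  have h1 : Shrinkage.vhatTargetKnown 0 T (ofCols x)
      = (∑ k, a k ^ 2 - 1 / n * (∑ k, a k) ^ 2) / (n * (n - 1)) / (p : ℝ) ^ 2 := by
    have e : ∀ k, Shrinkage.inner (Shrinkage.outer (Shrinkage.centerAt 0 (ofCols x)) k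
        - Shrinkage.covKnown 0 (ofCols x)) T ^ 2
        = (a k ^ 2 - 2 / n * (∑ l, a l) * a k + (1 / n * ∑ l, a l) ^ 2) / (p : ℝ) ^ 2 := by
      intro k
      rw [inner_sub_left, inner_covKnown_ofCols, centerAt_zero, outer_ofCols, inner_vecMulVec]
      simp only [← ha]
      ring
    rw [Shrinkage.vhatTargetKnown]
    simp only [e, ← Finset.sum_div, Finset.sum_add_distrib, Finset.sum_sub_distrib,
      ← Finset.mul_sum, Finset.sum_const, Finset.card_univ, Fintype.card_fin, nsmul_eq_mul]
    field_simp
    ring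
  have h2 : ∑ e : Fin 2 ↪ Fin n, kernelKnown n T (fun i => x (e i))
      = (2 * n * ∑ k, a k ^ 2 - 2 * (∑ k, a k) ^ 2) / (2 * n * (p : ℝ) ^ 2) := by
    simp only [kernelKnown, ← Finset.sum_div]
    congr 1
    rw [sum_embedding_two fun k l => (a k - a l) ^ 2]
    have e : ∀ k l, (if k ≠ l then (a k - a l) ^ 2 else 0)
        = a k ^ 2 - 2 * a k * a l + a l ^ 2 := by
      intro k l
      by_cases h : k = l
      · subst h
        simp
        ring
      · simp only [ne_eq, h, not_false_eq_true, if_true]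
        ring
    simp only [e, Finset.sum_add_distrib, Finset.sum_sub_distrib, ← Finset.mul_sum,
      Finset.sum_const, Finset.card_univ, Fintype.card_fin, nsmul_eq_mul, ← Finset.sum_mul]
    ring
  rw [h1, average, h2, card_embedding_two hn]
  rcases eq_or_ne (p : ℝ) 0 with hp | hp
  · simp [hp]
  · field_simp

theorem vhatTargetUnknown_eq (hp : 1 ≤ p) (hn : 4 ≤ n)
    (x : Fin n → Fin p → ℝ) :
    Shrinkage.vhatTargetUnknown T (ofCols x)
      = 1 / (p : ℝ) ^ 2 * (1 / ((n - 2) * (n - 3))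
          * ∑ k, bilin T (deviation x k) (deviation x k) ^ 2
        - 2 / (n * (n - 1) * (n - 2) * (n - 3))
          * ∑ k, ∑ l, bilin T (deviation x k) (deviation x l) ^ 2
        - ((n : ℝ) ^ 2 - 2 * n - 1) / ((n - 1) ^ 2 * n * (n - 2) * (n - 3))
          * (∑ k, bilin T (deviation x k) (deviation x k)) ^ 2) := by
  have hn' : (4 : ℝ) ≤ n := by exact_mod_cast hn
  have hn0 : (n : ℝ) ≠ 0 := by positivity
  have hn1 : (n : ℝ) - 1 ≠ 0 := by linarith
  have hn2 : (n : ℝ) - 2 ≠ 0 := by linarith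
  have hn3 : (n : ℝ) - 3 ≠ 0 := by linarith
  have hp0 : (p : ℝ) ≠ 0 := by positivity
  rw [Shrinkage.vhatTargetUnknown, Shrinkage.bbarTarget, inner_covUnknown_mul_ofCols,
    inner_covUnknown_ofCols, centerEmp_ofCols]
  simp only [outer_ofCols, inner_vecMulVec, div_pow, ← Finset.sum_div]
  generalize ∑ k, bilin T (deviation x k) (deviation x k) ^ 2 = A
  generalize ∑ k, ∑ l, bilin T (deviation x k) (deviation x l) ^ 2 = C
  generalize ∑ k, bilin T (deviation x k) (deviation x k) = τ
  field_simp
  ring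

/-- The kernel only sees differences of observations, which are differences of deviations. Hence
both sides are functions of the Gram matrix `s` of the deviations, and the three kernel sums turn
the claim into a rational identity in ∑ s_kk², ∑∑ s_kl² and ∑ s_kk. -/
theorem vhatTargetUnknown_eq_average (hp : 1 ≤ p) (hn : 4 ≤ n) (hT : T.IsSymm)
    (x : Fin n → Fin p → ℝ) :
    Shrinkage.vhatTargetUnknown T (ofCols x) = average (kernelUnknown n T) x := by
  have hn' : (4 : ℝ) ≤ n := by exact_mod_cast hn
  have hn0 : (n : ℝ) ≠ 0 := by positivity
  have hn1 : (n : ℝ) - 1 ≠ 0 := by linarith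
  have hn2 : (n : ℝ) - 2 ≠ 0 := by linarith
  have hn3 : (n : ℝ) - 3 ≠ 0 := by linarith
  have hp0 : (p : ℝ) ≠ 0 := by positivity
  set s : Fin n → Fin n → ℝ := fun k l => bilin T (deviation x k) (deviation x l) with hs
  have hsymm : ∀ k l, s k l = s l k := fun k l => bilin_comm hT _ _
  have hrow : ∀ k, ∑ l, s k l = 0 := fun k => sum_bilin_deviation x k
  have hb : ∀ k l r t, bilin T (x k - x l) (x r - x t) = s k r - s k t - (s l r - s l t) := by
    intro k l r t
    rw [← deviation_sub x k l, ← deviation_sub x r t, bilin_sub_left, bilin_sub_right,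
      bilin_sub_right]
  have hd : ∀ k l, bilin T (x k - x l) (x k - x l) = s k k - 2 * s k l + s l l := by
    intro k l
    rw [hb, hsymm l k]
    ring
  rw [vhatTargetUnknown_eq hp hn, average, card_embedding_four hn]
  simp only [kernelUnknown, hd, ← Finset.sum_div, Finset.sum_sub_distrib, ← Finset.mul_sum]
  simp only [hb, sum_embedding_distance_sq s hsymm hrow, sum_embedding_distance_mul s hsymm hrow,
    sum_embedding_cross_sq s hsymm hrow]
  change 1 / (p : ℝ) ^ 2 * (1 / ((n - 2) * (n - 3)) * ∑ k, s k k ^ 2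
        - 2 / (n * (n - 1) * (n - 2) * (n - 3)) * ∑ k, ∑ l, s k l ^ 2
        - ((n : ℝ) ^ 2 - 2 * n - 1) / ((n - 1) ^ 2 * n * (n - 2) * (n - 3))
          * (∑ k, s k k) ^ 2) = _
  generalize ∑ k, s k k ^ 2 = A
  generalize ∑ k, ∑ l, s k l ^ 2 = C
  generalize ∑ k, s k k = τ
  field_simp
  ring

end Estimators

end UStat

namespace UStat

/-! ### Expectations of the kernels and variances of the empirical covariances. -/

section Expectations

variable {p n : ℕ} {T : Matrix (Fin p) (Fin p) ℝ} {κ : Type*} [Fintype κ]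
  (ν : Measure (Fin p → ℝ)) [IsProbabilityMeasure ν]

theorem memLp_bilin_comb (hL : ∀ i, MemLp (fun x => x i) 4 ν) (a b : κ → ℝ) :
    MemLp (fun x : κ → Fin p → ℝ => bilin T (∑ k, a k • x k) (∑ k, b k • x k)) 2
      (Measure.pi fun _ => ν) := by
  simp only [bilin_sum_smul]
  exact memLp_finsetSum _ fun k _ => memLp_finsetSum _ fun l _ =>
    (memLp_bilin ν hL k l).const_mul _

theorem integrable_bilin_comb_mul (hL : ∀ i, MemLp (fun x => x i) 4 ν) (a b c d : κ → ℝ) :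
    Integrable (fun x : κ → Fin p → ℝ => bilin T (∑ k, a k • x k) (∑ k, b k • x k)
        * bilin T (∑ k, c k • x k) (∑ k, d k • x k)) (Measure.pi fun _ => ν) :=
  (memLp_bilin_comb ν hL a b).integrable_mul (memLp_bilin_comb ν hL c d)

theorem integral_bilin_of_ne (hL : ∀ i, MemLp (fun x => x i) 4 ν)
    (hmean : ∀ i, ∫ x, x i ∂ν = 0) {k l : κ} (hkl : k ≠ l) :
    ∫ x : κ → Fin p → ℝ, bilin T (x k) (x l) ∂(Measure.pi fun _ => ν) = 0 := by
  have hk := fun (k : κ) i => (memLp_eval ν hL k i).integrable (by norm_num)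
  have hi : ∀ i j, IndepFun (fun x : κ → Fin p → ℝ => x k i) (fun x => x l j)
      (Measure.pi fun _ => ν) := fun i j =>
    ((iIndepFun_eval (κ := κ) ν).indepFun hkl).comp (measurable_pi_apply i) (measurable_pi_apply j)
  have hint : ∀ i j, Integrable (fun x : κ → Fin p → ℝ => T i j * (x k i * x l j))
      (Measure.pi fun _ => ν) := fun i j =>
    ((hi i j).integrable_mul (hk k i) (hk l j)).const_mul _
  have h0 : ∀ i, ∫ x : κ → Fin p → ℝ, x k i ∂(Measure.pi fun _ => ν) = 0 := by
    intro i
    have hm := measurePreserving_eval (fun _ : κ => ν) k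
    rw [← hmean i]
    conv_rhs => rw [← hm.map_eq]
    rw [integral_map hm.measurable.aemeasurable (measurable_pi_apply i).aestronglyMeasurable]
  simp only [bilin_eq_sum]
  rw [integral_finsetSum _ fun i _ => integrable_finsetSum _ fun j _ => hint i j]
  refine Finset.sum_eq_zero fun i _ => ?_
  rw [integral_finsetSum _ fun j _ => hint i j]
  refine Finset.sum_eq_zero fun j _ => ?_
  rw [integral_const_mul, (hi i j).integral_fun_mul_eq_mul_integral (hk k i).aestronglyMeasurable
    (hk l j).aestronglyMeasurable, h0 i, zero_mul, mul_zero]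

theorem integral_bilin_comb (hL : ∀ i, MemLp (fun x => x i) 4 ν)
    (hmean : ∀ i, ∫ x, x i ∂ν = 0) (a b : κ → ℝ) :
    ∫ x : κ → Fin p → ℝ, bilin T (∑ k, a k • x k) (∑ k, b k • x k) ∂(Measure.pi fun _ => ν)
      = formMean T ν * ∑ k, a k * b k := by
  classical
  have hint : ∀ k l : κ, Integrable (fun x : κ → Fin p → ℝ => a k * b l * bilin T (x k) (x l))
      (Measure.pi fun _ => ν) := fun k l =>
    ((memLp_bilin ν hL k l).integrable (by norm_num)).const_mul _
  have h : ∀ k l : κ, ∫ x : κ → Fin p → ℝ, bilin T (x k) (x l) ∂(Measure.pi fun _ => ν)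
      = if k = l then formMean T ν else 0 := by
    intro k l
    split_ifs with hkl
    · subst hkl
      exact integral_bilin_self ν k
    · exact integral_bilin_of_ne ν hL hmean hkl
  simp only [bilin_sum_smul]
  rw [integral_finsetSum _ fun k _ => integrable_finsetSum _ fun l _ => hint k l, Finset.mul_sum]
  refine Finset.sum_congr rfl fun k _ => ?_
  rw [integral_finsetSum _ fun l _ => hint k l]
  simp [integral_const_mul, h]
  ring

/-- First two moments of a sum of quadratic forms in linear combinations. -/
theorem integral_sum_bilin_comb_sub_sq {ι : Type*} [Fintype ι] (hT : T.IsSymm)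
    (hL : ∀ i, MemLp (fun x => x i) 4 ν) (hmean : ∀ i, ∫ x, x i ∂ν = 0) (a : ι → κ → ℝ)
    (c : ℝ) (hc : c * ∑ j, ∑ k, a j k ^ 2 = 1) :
    ∫ x : κ → Fin p → ℝ, (c * ∑ j, bilin T (∑ k, a j k • x k) (∑ k, a j k • x k)
        - formMean T ν) ^ 2 ∂(Measure.pi fun _ => ν)
      = c ^ 2 * (2 * formCross T ν * (∑ i, ∑ j, (∑ k, a i k * a j k) ^ 2)
        + (formSq T ν - formMean T ν ^ 2 - 2 * formCross T ν) * ∑ k, (∑ j, a j k ^ 2) ^ 2) := by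
  set W : (κ → Fin p → ℝ) → ℝ := fun x =>
    ∑ j, bilin T (∑ k, a j k • x k) (∑ k, a j k • x k) with hW
  have hWL : MemLp W 2 (Measure.pi fun _ => ν) :=
    memLp_finsetSum _ fun j _ => memLp_bilin_comb ν hL (a j) (a j)
  have hW1 : ∫ x, W x ∂(Measure.pi fun _ => ν) = formMean T ν * ∑ j, ∑ k, a j k ^ 2 := by
    simp only [hW]
    rw [integral_finsetSum _ fun j _ => (memLp_bilin_comb ν hL (a j) (a j)).integrable
      (by norm_num), Finset.mul_sum]
    refine Finset.sum_congr rfl fun j _ => ?_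
    rw [integral_bilin_comb ν hL hmean]
    simp only [sq]
  have hW2 : ∫ x, W x ^ 2 ∂(Measure.pi fun _ => ν)
      = formMean T ν ^ 2 * (∑ j, ∑ k, a j k ^ 2) ^ 2
        + 2 * formCross T ν * (∑ i, ∑ j, (∑ k, a i k * a j k) ^ 2)
        + (formSq T ν - formMean T ν ^ 2 - 2 * formCross T ν) * ∑ k, (∑ j, a j k ^ 2) ^ 2 := by
    have hint := fun i j => integrable_bilin_comb_mul (T := T) ν hL (a i) (a i) (a j) (a j)
    have e0 : ∀ x, W x ^ 2 = ∑ i, ∑ j, bilin T (∑ k, a i k • x k) (∑ k, a i k • x k)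
        * bilin T (∑ k, a j k • x k) (∑ k, a j k • x k) := by
      intro x
      rw [sq, Finset.sum_mul_sum]
    have hA : (∑ j, ∑ k, a j k ^ 2) ^ 2
        = ∑ i, ∑ j, (∑ k, a i k * a i k) * ∑ k, a j k * a j k := by
      rw [sq, Finset.sum_mul_sum]
      simp only [sq]
    have hB : ∑ k, (∑ j, a j k ^ 2) ^ 2 = ∑ i, ∑ j, ∑ k, a i k * a i k * a j k * a j k := by
      simp only [sq, Finset.sum_mul_sum]
      rw [Finset.sum_comm]
      refine Finset.sum_congr rfl fun i _ => ?_
      rw [Finset.sum_comm]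
      exact Finset.sum_congr rfl fun j _ => Finset.sum_congr rfl fun k _ => by ring
    simp only [e0]
    rw [integral_finsetSum _ fun i _ => integrable_finsetSum _ fun j _ => hint i j]
    simp_rw [integral_finsetSum _ fun j _ => hint _ j, integral_bilin_comb_mul ν hT hL hmean]
    rw [hA, hB]
    simp only [Finset.sum_add_distrib, ← Finset.mul_sum, sq]
    ring
  have e1 : ∀ x, (c * W x - formMean T ν) ^ 2
      = c ^ 2 * W x ^ 2 - 2 * c * formMean T ν * W x + formMean T ν ^ 2 := fun x => by ring
  have i1 : Integrable (fun x => c ^ 2 * W x ^ 2) (Measure.pi fun _ => ν) :=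
    hWL.integrable_sq.const_mul _
  have i2 : Integrable (fun x => 2 * c * formMean T ν * W x) (Measure.pi fun _ => ν) :=
    (hWL.integrable (by norm_num)).const_mul _
  have i3 : Integrable (fun x => c ^ 2 * W x ^ 2 - 2 * c * formMean T ν * W x)
    (Measure.pi fun _ => ν) := i1.sub i2
  calc _ = ∫ x, (c * W x - formMean T ν) ^ 2 ∂(Measure.pi fun _ => ν) := rfl
    _ = _ := by
      simp only [e1]
      rw [integral_add i3 (integrable_const _), integral_sub i1 i2, integral_const_mul,
        integral_const_mul, hW1, hW2]
      simp only [integral_const, probReal_univ, one_smul]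
      -- By `hc`, c W has mean `formMean T ν`; the terms in its square collect to `formMean ^ 2`
      -- times (c ∑∑ a² - 1)².
      linear_combination (formMean T ν ^ 2 * (c * (∑ j, ∑ k, a j k ^ 2) - 1)) * hc

theorem integral_kernelKnown (hL : ∀ i, MemLp (fun x => x i) 4 ν) :
    Integrable (kernelKnown n T) (Measure.pi fun _ => ν) ∧
    ∫ z, kernelKnown n T z ∂(Measure.pi fun _ => ν)
      = (formSq T ν - formMean T ν ^ 2) / n / (p : ℝ) ^ 2 := by
  have b : ∀ i : Fin 2, MemLp (fun z : Fin 2 → Fin p → ℝ => bilin T (z i) (z i)) 2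
    (Measure.pi fun _ => ν) := fun i => memLp_bilin ν hL i i
  have i1 : ∀ i j : Fin 2, Integrable (fun z : Fin 2 → Fin p → ℝ =>
      bilin T (z i) (z i) * bilin T (z j) (z j)) (Measure.pi fun _ => ν) :=
    fun i j => (b i).integrable_mul (b j)
  have e : ∀ z : Fin 2 → Fin p → ℝ, kernelKnown n T z
      = (bilin T (z 0) (z 0) * bilin T (z 0) (z 0) + bilin T (z 1) (z 1) * bilin T (z 1) (z 1)
        - 2 * (bilin T (z 0) (z 0) * bilin T (z 1) (z 1))) / (2 * n * (p : ℝ) ^ 2) := by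
    intro z
    rw [kernelKnown]
    ring
  have i2 : Integrable (fun z : Fin 2 → Fin p → ℝ =>
      bilin T (z 0) (z 0) * bilin T (z 0) (z 0) + bilin T (z 1) (z 1) * bilin T (z 1) (z 1))
      (Measure.pi fun _ => ν) := (i1 0 0).add (i1 1 1)
  have i3 : Integrable (fun z : Fin 2 → Fin p → ℝ =>
      2 * (bilin T (z 0) (z 0) * bilin T (z 1) (z 1)))
      (Measure.pi fun _ => ν) := (i1 0 1).const_mul 2
  simp only [funext e]
  refine ⟨(i2.sub i3).div_const _, ?_⟩
  rw [integral_div, integral_sub i2 i3, integral_add (i1 0 0) (i1 1 1), integral_const_mul,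
    integral_bilin_self_sq, integral_bilin_self_sq,
    integral_bilin_self_mul_self ν (by simp : (0 : Fin 2) ≠ 1)]
  field_simp
  ring

/-- Write d = z₀ - z₁, d' = z₂ - z₃, and μ, q, γ for `formMean`, `formSq`, `formCross`. Then E
T(d,d)² = 2q + 2μ² + 4γ, E T(d,d)T(d',d') = 4μ² and E T(d,d')² = 4γ. The first two produce (q -
μ²)/n + 2γ/n; the coefficient (n - 2)/(2n(n - 1)) of the third lowers 2γ/n to 2γ/(n(n - 1)), as in
the variance of the sample covariance. -/
theorem integral_kernelUnknown (hn : 2 ≤ n) (hT : T.IsSymm) (hL : ∀ i, MemLp (fun x => x i) 4 ν)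
    (hmean : ∀ i, ∫ x, x i ∂ν = 0) :
    Integrable (kernelUnknown n T) (Measure.pi fun _ => ν) ∧
    ∫ z, kernelUnknown n T z ∂(Measure.pi fun _ => ν)
      = ((formSq T ν - formMean T ν ^ 2) / n + 2 * formCross T ν / (n * (n - 1))) / (p : ℝ) ^ 2 := by
  have h01 : ∀ z : Fin 4 → Fin p → ℝ, z 0 - z 1 = ∑ k, (![1, -1, 0, 0] : Fin 4 → ℝ) k • z k := by
    intro z
    simp [Fin.sum_univ_four, sub_eq_add_neg]
  have h23 : ∀ z : Fin 4 → Fin p → ℝ, z 2 - z 3 = ∑ k, (![0, 0, 1, -1] : Fin 4 → ℝ) k • z k := by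
    intro z
    simp [Fin.sum_univ_four, sub_eq_add_neg]
  have hn' : (2 : ℝ) ≤ n := by exact_mod_cast hn
  have hn0 : (n : ℝ) ≠ 0 := by positivity
  have hn1 : (n : ℝ) - 1 ≠ 0 := by linarith
  have i1 := integrable_bilin_comb_mul (T := T) ν hL ![1, -1, 0, 0] ![1, -1, 0, 0]
    ![1, -1, 0, 0] ![1, -1, 0, 0]
  have i2 := integrable_bilin_comb_mul (T := T) ν hL ![1, -1, 0, 0] ![1, -1, 0, 0]
    ![0, 0, 1, -1] ![0, 0, 1, -1]
  have i3 := integrable_bilin_comb_mul (T := T) ν hL ![1, -1, 0, 0] ![0, 0, 1, -1]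
    ![1, -1, 0, 0] ![0, 0, 1, -1]
  have v1 := integral_bilin_comb_mul ν hT hL hmean ![1, -1, 0, 0] ![1, -1, 0, 0]
    ![1, -1, 0, 0] ![1, -1, 0, 0]
  have v2 := integral_bilin_comb_mul ν hT hL hmean ![1, -1, 0, 0] ![1, -1, 0, 0]
    ![0, 0, 1, -1] ![0, 0, 1, -1]
  have v3 := integral_bilin_comb_mul ν hT hL hmean ![1, -1, 0, 0] ![0, 0, 1, -1]
    ![1, -1, 0, 0] ![0, 0, 1, -1]
  simp only [← h01, ← h23] at i1 i2 i3 v1 v2 v3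
  simp [Fin.sum_univ_four] at v1 v2 v3
  have e : ∀ z : Fin 4 → Fin p → ℝ, kernelUnknown n T z
      = (1 / (2 * n) * (bilin T (z 0 - z 1) (z 0 - z 1) * bilin T (z 0 - z 1) (z 0 - z 1)
      - bilin T (z 0 - z 1) (z 0 - z 1) * bilin T (z 2 - z 3) (z 2 - z 3))
    - (n - 2) / (2 * n * (n - 1)) * (bilin T (z 0 - z 1) (z 2 - z 3)
      * bilin T (z 0 - z 1) (z 2 - z 3))) / (p : ℝ) ^ 2 := by
    intro z
    rw [kernelUnknown]
    ring
  simp only [funext e]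
  refine ⟨(((i1.sub i2).const_mul _).sub (i3.const_mul _)).div_const _, ?_⟩
  have i4 : Integrable (fun z : Fin 4 → Fin p → ℝ =>
      bilin T (z 0 - z 1) (z 0 - z 1) * bilin T (z 0 - z 1) (z 0 - z 1)
      - bilin T (z 0 - z 1) (z 0 - z 1) * bilin T (z 2 - z 3) (z 2 - z 3))
      (Measure.pi fun _ => ν) := i1.sub i2
  rw [integral_div, integral_sub (i4.const_mul _) (i3.const_mul _), integral_const_mul,
    integral_const_mul, integral_sub i1 i2, v1, v2, v3]
  field_simp
  ring

theorem integral_inner_covKnown_sub_sq (hn : 1 ≤ n) (hT : T.IsSymm)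
    (hL : ∀ i, MemLp (fun x => x i) 4 ν) (hmean : ∀ i, ∫ x, x i ∂ν = 0)
    {S : Matrix (Fin p) (Fin p) ℝ} (hS : Shrinkage.inner S T = formMean T ν / p) :
    MemLp (fun x : Fin n → Fin p → ℝ =>
      Shrinkage.inner (Shrinkage.covKnown 0 (ofCols x) - S) T) 2 (Measure.pi fun _ => ν) ∧
    ∫ x : Fin n → Fin p → ℝ, Shrinkage.inner (Shrinkage.covKnown 0 (ofCols x) - S) T ^ 2
      ∂(Measure.pi fun _ => ν) = (formSq T ν - formMean T ν ^ 2) / n / (p : ℝ) ^ 2 := by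
  have hn0 : (n : ℝ) ≠ 0 := by positivity
  -- With no empirical centering the coefficient matrix is the identity.
  have e : ∀ x : Fin n → Fin p → ℝ, Shrinkage.inner (Shrinkage.covKnown 0 (ofCols x) - S) T
      = (1 / (n : ℝ) * ∑ j, bilin T (∑ k, (Pi.single j 1 : Fin n → ℝ) k • x k)
        (∑ k, (Pi.single j 1 : Fin n → ℝ) k • x k) - formMean T ν) / p := by
    intro x
    rw [inner_sub_left, inner_covKnown_ofCols, hS]
    simp [Pi.single_apply]
    ring
  simp only [e]
  constructor
  · simp only [div_eq_inv_mul]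
    exact (((memLp_finsetSum _ fun j _ => memLp_bilin_comb ν hL _ _).const_mul _).sub
      (memLp_const _)).const_mul _
  · simp only [div_pow]
    rw [integral_div, integral_sum_bilin_comb_sub_sq ν hT hL hmean _ _
      (by simp [Pi.single_apply, hn0])]
    congr 1
    simp [Pi.single_apply]
    field_simp
    ring

theorem integral_inner_covUnknown_sub_sq (hn : 2 ≤ n) (hT : T.IsSymm)
    (hL : ∀ i, MemLp (fun x => x i) 4 ν) (hmean : ∀ i, ∫ x, x i ∂ν = 0)
    {S : Matrix (Fin p) (Fin p) ℝ} (hS : Shrinkage.inner S T = formMean T ν / p) :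
    MemLp (fun x : Fin n → Fin p → ℝ =>
      Shrinkage.inner (Shrinkage.covUnknown (ofCols x) - S) T) 2 (Measure.pi fun _ => ν) ∧
    ∫ x : Fin n → Fin p → ℝ, Shrinkage.inner (Shrinkage.covUnknown (ofCols x) - S) T ^ 2
      ∂(Measure.pi fun _ => ν)
      = ((formSq T ν - formMean T ν ^ 2) / n + 2 * formCross T ν / (n * (n - 1))) / (p : ℝ) ^ 2 := by
  have hn' : (2 : ℝ) ≤ n := by exact_mod_cast hn
  have hn0 : (n : ℝ) ≠ 0 := by positivity
  have hn1 : (n : ℝ) - 1 ≠ 0 := by linarith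
  -- The centering matrix I - J/n, J being all ones: a symmetric projection of rank n - 1. Hence a
  -- aᵀ = a, rows and columns have square norm 1 - 1/n, and the squares of all entries of a aᵀ sum
  -- to n - 1.
  set a : Fin n → Fin n → ℝ := fun j k => (if k = j then 1 else 0) - 1 / (n : ℝ) with ha
  have hdev : ∀ (x : Fin n → Fin p → ℝ) j, deviation x j = ∑ k, a j k • x k := by
    intro x j
    simp [deviation, ha, sub_smul, Finset.sum_sub_distrib, Finset.smul_sum]
  have haa : ∀ i j, ∑ k, a i k * a j k = (if i = j then 1 else 0) - 1 / (n : ℝ) := by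
    intro i j
    have : ∀ k, a i k * a j k = (if k = i then (if k = j then 1 else 0) else 0)
        - (if k = i then 1 / (n : ℝ) else 0) - (if k = j then 1 / (n : ℝ) else 0)
        + 1 / (n : ℝ) * (1 / n) := by
      intro k
      simp only [ha]
      split_ifs <;> ring
    simp only [this, Finset.sum_add_distrib, Finset.sum_sub_distrib, Finset.sum_ite_eq',
      Finset.mem_univ, if_true, Finset.sum_const, Finset.card_univ, Fintype.card_fin, nsmul_eq_mul]
    field_simp
    ring
  have hcol : ∀ k, ∑ j, a j k ^ 2 = 1 - 1 / (n : ℝ) := by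
    intro k
    have : ∀ j, a j k = a k j := by
      intro j
      simp only [ha, eq_comm]
    simp only [this, sq, haa, if_true]
  have hrow : ∀ j, ∑ k, a j k ^ 2 = 1 - 1 / (n : ℝ) := by
    intro j
    simp only [sq, haa, if_true]
  have hcross : ∑ i, ∑ j, (∑ k, a i k * a j k) ^ 2 = (n : ℝ) - 1 := by
    have : ∀ i j : Fin n, ((if i = j then 1 else 0) - 1 / (n : ℝ)) ^ 2
        = (if i = j then 1 - 2 / (n : ℝ) else 0) + 1 / (n : ℝ) ^ 2 := by
      intro i j
      split_ifs <;> ring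
    simp only [haa, this, Finset.sum_add_distrib, Finset.sum_ite_eq, Finset.mem_univ, if_true,
      Finset.sum_const, Finset.card_univ, Fintype.card_fin, nsmul_eq_mul]
    field_simp
    ring
  have e : ∀ x : Fin n → Fin p → ℝ, Shrinkage.inner (Shrinkage.covUnknown (ofCols x) - S) T
      = (1 / ((n : ℝ) - 1) * ∑ j, bilin T (∑ k, a j k • x k) (∑ k, a j k • x k)
        - formMean T ν) / p := by
    intro x
    rw [inner_sub_left, inner_covUnknown_ofCols, hS]
    simp only [← hdev]
    ring
  simp only [e]
  constructor
  · simp only [div_eq_inv_mul]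
    exact (((memLp_finsetSum _ fun j _ => memLp_bilin_comb ν hL _ _).const_mul _).sub
      (memLp_const _)).const_mul _
  · simp only [div_pow]
    rw [integral_div, integral_sum_bilin_comb_sub_sq ν hT hL hmean a _ ?_]
    · congr 1
      simp only [hcol, hcross, Finset.sum_const, Finset.card_univ, Fintype.card_fin, nsmul_eq_mul]
      field_simp
      ring
    · simp only [hrow, Finset.sum_const, Finset.card_univ, Fintype.card_fin, nsmul_eq_mul]
      field_simp

end Expectations

end UStat

namespace UStat

/-! ### Kernel bounds that do not depend on the number of targets. -/

section Bounds

variable {p n : ℕ}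

/-- Bessel's inequality for a finite family of matrices. -/
def IsBessel {ι : Type*} [Fintype ι] (T : ι → Matrix (Fin p) (Fin p) ℝ) : Prop :=
  ∀ M, ∑ τ, Shrinkage.inner M (T τ) ^ 2 ≤ Shrinkage.norm M ^ 2

variable {ι : Type*} [Fintype ι] {T : ι → Matrix (Fin p) (Fin p) ℝ}

theorem dotProduct_self_nonneg' (u : Fin p → ℝ) : 0 ≤ u ⬝ᵥ u :=
  Finset.sum_nonneg fun i _ => mul_self_nonneg (u i)

/-- Bessel's inequality for uvᵀ, whose coefficients are T(u,v)/p and whose square norm is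
|u|²|v|²/p. -/
theorem IsBessel.sum_bilin_sq_le (hB : IsBessel T) (hp : 1 ≤ p) (u v : Fin p → ℝ) :
    ∑ τ, bilin (T τ) u v ^ 2 ≤ p * ((u ⬝ᵥ u) * (v ⬝ᵥ v)) := by
  have hp0 : (0 : ℝ) < p := by exact_mod_cast hp
  have h := hB (Matrix.vecMulVec u v)
  have e : Shrinkage.norm (Matrix.vecMulVec u v) ^ 2 = (u ⬝ᵥ u) * (v ⬝ᵥ v) / p := by
    rw [norm_sq]
    congr 1
    simp only [Matrix.vecMulVec_apply, dotProduct, Finset.sum_mul_sum]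
    exact Finset.sum_congr rfl fun i _ => Finset.sum_congr rfl fun j _ => by ring
  simp only [inner_vecMulVec, div_pow, ← Finset.sum_div] at h
  rw [e, div_le_div_iff₀ (by positivity) hp0] at h
  nlinarith

theorem dotProduct_self_sub_le (u v : Fin p → ℝ) :
    (u - v) ⬝ᵥ (u - v) ≤ 2 * (u ⬝ᵥ u + v ⬝ᵥ v) := by
  have := dotProduct_self_nonneg' (u + v)
  simp only [sub_dotProduct, dotProduct_sub, add_dotProduct, dotProduct_add] at this ⊢
  linarith

theorem sq_dotProduct_self_sub_le (u v : Fin p → ℝ) :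
    ((u - v) ⬝ᵥ (u - v)) ^ 2 ≤ 8 * ((u ⬝ᵥ u) ^ 2 + (v ⬝ᵥ v) ^ 2) := by
  have h1 := dotProduct_self_sub_le u v
  have h0 := dotProduct_self_nonneg' (u - v)
  nlinarith [sq_nonneg (u ⬝ᵥ u - v ⬝ᵥ v), pow_le_pow_left₀ h0 h1 2]

theorem abs_sum_kernelKnown_le (hB : IsBessel T) (hp : 1 ≤ p) (z : Fin 2 → Fin p → ℝ) :
    |∑ τ, kernelKnown n (T τ) z| ≤ 1 / (n * p) * ∑ i, (z i ⬝ᵥ z i) ^ 2 := by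
  have hp0 : (0 : ℝ) < p := by exact_mod_cast hp
  have h0 := hB.sum_bilin_sq_le hp (z 0) (z 0)
  have h1 := hB.sum_bilin_sq_le hp (z 1) (z 1)
  rw [abs_of_nonneg (Finset.sum_nonneg fun τ _ => by unfold kernelKnown; positivity)]
  simp only [kernelKnown, ← Finset.sum_div, Fin.sum_univ_two]
  have h2 : ∑ τ, (bilin (T τ) (z 0) (z 0) - bilin (T τ) (z 1) (z 1)) ^ 2
      ≤ 2 * (p * ((z 0 ⬝ᵥ z 0) ^ 2 + (z 1 ⬝ᵥ z 1) ^ 2)) := by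
    calc _ ≤ ∑ τ, (2 * bilin (T τ) (z 0) (z 0) ^ 2 + 2 * bilin (T τ) (z 1) (z 1) ^ 2) :=
          Finset.sum_le_sum fun τ _ => by
            nlinarith [sq_nonneg (bilin (T τ) (z 0) (z 0) + bilin (T τ) (z 1) (z 1))]
      _ ≤ _ := by
          rw [Finset.sum_add_distrib, ← Finset.mul_sum, ← Finset.mul_sum]
          linarith
  rcases Nat.eq_zero_or_pos n with rfl | hn
  · simp
  · have hn0 : (0 : ℝ) < n := by exact_mod_cast hn
    calc _ ≤ 2 * (p * ((z 0 ⬝ᵥ z 0) ^ 2 + (z 1 ⬝ᵥ z 1) ^ 2)) / (2 * n * (p : ℝ) ^ 2) := by gcongr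
      _ = _ := by field_simp

theorem abs_sum_kernelUnknown_le (hB : IsBessel T) (hp : 1 ≤ p) (hn : 2 ≤ n)
    (z : Fin 4 → Fin p → ℝ) :
    |∑ τ, kernelUnknown n (T τ) z| ≤ 8 / (n * p) * ∑ i, (z i ⬝ᵥ z i) ^ 2 := by
  have hp0 : (0 : ℝ) < p := by exact_mod_cast hp
  have hn0 : (2 : ℝ) ≤ n := by exact_mod_cast hn
  set d := z 0 - z 1
  set d' := z 2 - z 3
  have h0 := hB.sum_bilin_sq_le hp d d
  have h1 := hB.sum_bilin_sq_le hp d' d'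
  have h2 := hB.sum_bilin_sq_le hp d d'
  have hd : (d ⬝ᵥ d) ^ 2 ≤ 8 * ((z 0 ⬝ᵥ z 0) ^ 2 + (z 1 ⬝ᵥ z 1) ^ 2) :=
    sq_dotProduct_self_sub_le _ _
  have hd' : (d' ⬝ᵥ d') ^ 2 ≤ 8 * ((z 2 ⬝ᵥ z 2) ^ 2 + (z 3 ⬝ᵥ z 3) ^ 2) :=
    sq_dotProduct_self_sub_le _ _
  have hq0 : (0 : ℝ) ≤ (n - 2) / (n - 1) := div_nonneg (by linarith) (by linarith)
  have hq1 : ((n : ℝ) - 2) / (n - 1) ≤ 1 := (div_le_one (by linarith)).2 (by linarith)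
  have h3 : |∑ τ, (bilin (T τ) d d ^ 2 - bilin (T τ) d d * bilin (T τ) d' d'
      - (n - 2) / (n - 1) * bilin (T τ) d d' ^ 2)|
      ≤ 2 * p * ((d ⬝ᵥ d) ^ 2 + (d' ⬝ᵥ d') ^ 2) := by
    -- The product is split by ab ≤ (a² + b²)/2, and (n - 2)/(n - 1) ≤ 1. Only sums of squares
    -- remain, to which Bessel applies.
    calc _ ≤ ∑ τ, (3 / 2 * bilin (T τ) d d ^ 2 + 1 / 2 * bilin (T τ) d' d' ^ 2
          + bilin (T τ) d d' ^ 2) := by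
          refine (Finset.abs_sum_le_sum_abs _ _).trans (Finset.sum_le_sum fun τ _ => ?_)
          have hq2 := mul_le_mul_of_nonneg_right hq1 (sq_nonneg (bilin (T τ) d d'))
          have hq3 := mul_nonneg hq0 (sq_nonneg (bilin (T τ) d d'))
          rw [abs_le]
          constructor <;>
            nlinarith [sq_nonneg (bilin (T τ) d d - bilin (T τ) d' d'),
              sq_nonneg (bilin (T τ) d d + bilin (T τ) d' d'), sq_nonneg (bilin (T τ) d d)]
      _ ≤ 3 / 2 * (p * ((d ⬝ᵥ d) * (d ⬝ᵥ d))) + 1 / 2 * (p * ((d' ⬝ᵥ d') * (d' ⬝ᵥ d')))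
          + p * ((d ⬝ᵥ d) * (d' ⬝ᵥ d')) := by
          rw [Finset.sum_add_distrib, Finset.sum_add_distrib, ← Finset.mul_sum, ← Finset.mul_sum]
          linarith
      _ ≤ _ := by
          have := mul_nonneg hp0.le (sq_nonneg (d ⬝ᵥ d - d' ⬝ᵥ d'))
          have h' := mul_nonneg hp0.le (sq_nonneg (d' ⬝ᵥ d'))
          nlinarith
  have e : ∑ τ, kernelUnknown n (T τ) z
      = 1 / (2 * n * (p : ℝ) ^ 2) * ∑ τ, (bilin (T τ) d d ^ 2
        - bilin (T τ) d d * bilin (T τ) d' d' - (n - 2) / (n - 1) * bilin (T τ) d d' ^ 2) := by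
    rw [Finset.mul_sum]
    refine Finset.sum_congr rfl fun τ _ => ?_
    have : (n : ℝ) - 1 ≠ 0 := by linarith
    have : (n : ℝ) ≠ 0 := by linarith
    rw [kernelUnknown]
    field_simp
    simp only [d, d']
    ring
  rw [e, abs_mul, abs_of_nonneg (by positivity)]
  calc _ ≤ 1 / (2 * n * (p : ℝ) ^ 2) * (2 * p * ((d ⬝ᵥ d) ^ 2 + (d' ⬝ᵥ d') ^ 2)) := by gcongr
    -- The 8 comes from |u - v|⁴ ≤ 8(|u|⁴ + |v|⁴).
    _ ≤ 1 / (2 * n * (p : ℝ) ^ 2) * (2 * p * (8 * ∑ i, (z i ⬝ᵥ z i) ^ 2)) := by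
        gcongr
        rw [Fin.sum_univ_four]
        linarith
    _ = _ := by
        field_simp

end Bounds

/-! ### Second moments of kernels from the eighth moment of the norm. -/

section Moments

variable {p n m : ℕ} (ν : Measure (Fin p → ℝ)) [IsProbabilityMeasure ν]

theorem measurable_dotProduct_self : Measurable fun u : Fin p → ℝ => u ⬝ᵥ u := by
  unfold dotProduct
  fun_prop

/-- Square integrability of kernels of fourth order growth. -/
theorem memLp_of_abs_le {g : (Fin m → Fin p → ℝ) → ℝ} (hg : Measurable g) {c : ℝ}
    (hM : Integrable (fun u => (u ⬝ᵥ u) ^ 4) ν) (hle : ∀ z, |g z| ≤ c * ∑ i, (z i ⬝ᵥ z i) ^ 2) :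
    MemLp g 2 (Measure.pi fun _ => ν) ∧
    ∫ z, g z ^ 2 ∂(Measure.pi fun _ => ν) ≤ c ^ 2 * m ^ 2 * ∫ u, (u ⬝ᵥ u) ^ 4 ∂ν := by
  have hi : ∀ i : Fin m, Integrable (fun z : Fin m → Fin p → ℝ => (z i ⬝ᵥ z i) ^ 4)
      (Measure.pi fun _ => ν) := fun i =>
    (measurePreserving_eval (fun _ : Fin m => ν) i).integrable_comp_of_integrable hM
  have hi' : ∀ i : Fin m, ∫ z : Fin m → Fin p → ℝ, (z i ⬝ᵥ z i) ^ 4 ∂(Measure.pi fun _ => ν)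
      = ∫ u, (u ⬝ᵥ u) ^ 4 ∂ν := by
    intro i
    have hm := measurePreserving_eval (fun _ : Fin m => ν) i
    conv_rhs => rw [← hm.map_eq]
    rw [integral_map hm.measurable.aemeasurable
      (measurable_dotProduct_self.pow_const 4).aestronglyMeasurable]
  -- Cauchy-Schwarz gives one factor m; the m equal integrals give the other.
  have hsq : ∀ z, g z ^ 2 ≤ c ^ 2 * (m * ∑ i, (z i ⬝ᵥ z i) ^ 4) := by
    intro z
    have h1 : g z ^ 2 ≤ (c * ∑ i, (z i ⬝ᵥ z i) ^ 2) ^ 2 := by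
      rw [← sq_abs]
      exact pow_le_pow_left₀ (abs_nonneg _) (hle z) 2
    have h2 := sq_sum_le_card_mul_sum_sq (s := Finset.univ) (f := fun i => (z i ⬝ᵥ z i) ^ 2)
    simp only [Finset.card_univ, Fintype.card_fin, ← pow_mul] at h2
    rw [mul_pow] at h1
    exact h1.trans (mul_le_mul_of_nonneg_left h2 (sq_nonneg c))
  have hib : Integrable (fun z : Fin m → Fin p → ℝ => c ^ 2 * (m * ∑ i, (z i ⬝ᵥ z i) ^ 4))
      (Measure.pi fun _ => ν) :=
    ((integrable_finsetSum _ fun i _ => hi i).const_mul _).const_mul _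
  have hig : Integrable (fun z => g z ^ 2) (Measure.pi fun _ => ν) :=
    hib.mono' (hg.pow_const 2).aestronglyMeasurable (ae_of_all _ fun z => by
      rw [Real.norm_of_nonneg (sq_nonneg _)]
      exact hsq z)
  refine ⟨(memLp_two_iff_integrable_sq hg.aestronglyMeasurable).2 hig, ?_⟩
  refine (integral_mono hig hib hsq).trans (le_of_eq ?_)
  rw [integral_const_mul, integral_const_mul, integral_finsetSum _ fun i _ => hi i]
  simp [hi']
  ring

theorem memLp_four_of_integrable (hM : Integrable (fun u => (u ⬝ᵥ u) ^ 4) ν) (i : Fin p) :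
    MemLp (fun x : Fin p → ℝ => x i) 4 ν := by
  have h4 : Integrable (fun x : Fin p → ℝ => x i ^ 4) ν := by
    refine (hM.add (integrable_const 1)).mono'
      ((measurable_pi_apply i).pow_const 4).aestronglyMeasurable (ae_of_all _ fun x => ?_)
    have h0 : x i * x i ≤ x ⬝ᵥ x :=
      Finset.single_le_sum (f := fun j => x j * x j) (fun j _ => mul_self_nonneg _)
        (Finset.mem_univ i)
    have h1 : x i ^ 4 ≤ (x ⬝ᵥ x) ^ 2 := by
      calc x i ^ 4 = (x i * x i) ^ 2 := by ring
        _ ≤ _ := pow_le_pow_left₀ (mul_self_nonneg _) h0 2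
    rw [Real.norm_of_nonneg (by positivity)]
    simp only [Pi.add_apply]
    -- With t = |x|⁴ this is t ≤ t² + 1.
    nlinarith [sq_nonneg ((x ⬝ᵥ x) ^ 2 - 1)]
  have := (integrable_norm_rpow_iff (p := 4) (μ := ν)
    (measurable_pi_apply i).aestronglyMeasurable (by simp) (by simp)).1 (by
      simpa [Even.pow_abs (show Even 4 by decide)] using h4)
  exact this

end Moments

end UStat

namespace UStat

/-! ### Orthonormal families, the frame of symmetrized matrix units, and whole-matrix estimators. -/

section Frames

variable {p n : ℕ}

theorem inner_comm (A B : Matrix (Fin p) (Fin p) ℝ) :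
    Shrinkage.inner A B = Shrinkage.inner B A := by
  simp only [inner_eq_sum, mul_comm]

theorem norm_sq_eq_inner (A : Matrix (Fin p) (Fin p) ℝ) :
    Shrinkage.norm A ^ 2 = Shrinkage.inner A A := by
  rw [norm_sq]
  simp only [inner_eq_sum, sq]

/-- The residual M - B of the orthogonal projection B has nonnegative square norm ‖M‖² - ∑⟨M, T τ⟩².
-/
theorem isBessel_of_orthonormal {ι : Type*} [Fintype ι] [DecidableEq ι]
    {T : ι → Matrix (Fin p) (Fin p) ℝ}
    (hT : ∀ k l, Shrinkage.inner (T k) (T l) = if k = l then 1 else 0) : IsBessel T := by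
  intro M
  set B := ∑ τ, Shrinkage.inner M (T τ) • T τ with hB
  have h1 : Shrinkage.inner B M = ∑ τ, Shrinkage.inner M (T τ) ^ 2 := by
    rw [hB, inner_sum_left]
    refine Finset.sum_congr rfl fun τ _ => ?_
    rw [inner_smul_left, inner_comm (T τ) M, sq]
  have h2 : Shrinkage.inner B B = ∑ τ, Shrinkage.inner M (T τ) ^ 2 := by
    conv_lhs => rw [hB]
    rw [inner_sum_left]
    refine Finset.sum_congr rfl fun τ _ => ?_
    rw [inner_smul_left, inner_comm (T τ) B, hB, inner_sum_left]
    simp [inner_smul_left, hT, sq]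
  have h3 : 0 ≤ Shrinkage.inner (M - B) (M - B) := by
    rw [← norm_sq_eq_inner]
    positivity
  rw [inner_sub_left, inner_comm M, inner_comm B (M - B), inner_sub_left, inner_sub_left,
    inner_comm M B, h1, h2, ← norm_sq_eq_inner] at h3
  linarith

/-- The normalized symmetrized matrix units. -/
noncomputable def symUnit (q : Fin p × Fin p) : Matrix (Fin p) (Fin p) ℝ :=
  Matrix.of fun a b => Real.sqrt p / 2 *
    ((if a = q.1 then 1 else 0) * (if b = q.2 then 1 else 0)
      + (if a = q.2 then 1 else 0) * (if b = q.1 then 1 else 0))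

theorem symUnit_isSymm (q : Fin p × Fin p) : (symUnit q).IsSymm := by
  ext a b
  simp only [symUnit, Matrix.transpose_apply, Matrix.of_apply]
  ring

theorem inner_symUnit (A : Matrix (Fin p) (Fin p) ℝ) (q : Fin p × Fin p) :
    Shrinkage.inner A (symUnit q) = Real.sqrt p / 2 * (A q.1 q.2 + A q.2 q.1) / p := by
  rw [inner_eq_sum]
  congr 1
  simp only [symUnit, Matrix.of_apply, mul_add, Finset.sum_add_distrib]
  simp
  ring

theorem inner_symUnit_sq (A : Matrix (Fin p) (Fin p) ℝ) (q : Fin p × Fin p) :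
    Shrinkage.inner A (symUnit q) ^ 2 = (A q.1 q.2 + A q.2 q.1) ^ 2 / 4 / p := by
  rw [inner_symUnit, div_pow, mul_pow, div_pow, Real.sq_sqrt (Nat.cast_nonneg p)]
  rcases eq_or_ne (p : ℝ) 0 with hp | hp
  · simp [hp]
  · field_simp
    ring

/-- The squared coefficients of M sum to the square norm of its symmetric part. -/
theorem isBessel_symUnit : IsBessel (symUnit (p := p)) := by
  intro M
  rw [norm_sq]
  simp only [inner_symUnit_sq, ← Finset.sum_div]
  gcongr
  rw [Fintype.sum_prod_type]
  have h : ∑ i, ∑ j, (M i j + M j i) ^ 2 ≤ ∑ i, ∑ j, (2 * M i j ^ 2 + 2 * M j i ^ 2) :=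
    Finset.sum_le_sum fun i _ => Finset.sum_le_sum fun j _ => by
      nlinarith [sq_nonneg (M i j - M j i)]
  have h' : ∑ i, ∑ j, M j i ^ 2 = ∑ i, ∑ j, M i j ^ 2 := Finset.sum_comm
  simp only [Finset.sum_add_distrib, ← Finset.mul_sum, h'] at h
  linarith

/-- Parseval's identity for a frame that is not orthonormal: pairs are ordered, so each off-diagonal
unit occurs twice, with square norm 1/2. Indexing by all ordered pairs avoids separating the
diagonal. -/
theorem norm_sq_eq_sum_symUnit {A : Matrix (Fin p) (Fin p) ℝ} (hA : A.IsSymm) :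
    Shrinkage.norm A ^ 2 = ∑ q, Shrinkage.inner A (symUnit q) ^ 2 := by
  rw [norm_sq]
  simp only [inner_symUnit_sq, ← Finset.sum_div]
  congr 1
  rw [Fintype.sum_prod_type, Finset.sum_div]
  refine Finset.sum_congr rfl fun i _ => ?_
  rw [Finset.sum_div]
  refine Finset.sum_congr rfl fun j _ => ?_
  rw [hA.apply i j]
  ring

/-- The pair (i, j) contributes (S_ii S_jj + S_ij²)/2, and the products S_ii S_jj sum to the squared
trace. This is the origin of the trace term in `vhatUnknown`. -/
theorem sum_inner_mul_symUnit {S : Matrix (Fin p) (Fin p) ℝ} (hS : S.IsSymm) :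
    ∑ q, Shrinkage.inner (S * symUnit q) (symUnit q * S)
      = ((p : ℝ) * Shrinkage.norm S ^ 2 + (p * Shrinkage.inner S 1) ^ 2) / 2 := by
  rcases Nat.eq_zero_or_pos p with rfl | hp
  · simp
  have hp0 : (p : ℝ) ≠ 0 := by positivity
  have h1 : (p : ℝ) * Shrinkage.inner S 1 = ∑ i, S i i := by
    simp [Shrinkage.inner, Matrix.trace, mul_div_cancel₀ _ hp0]
  have h2 : (p : ℝ) * Shrinkage.norm S ^ 2 = ∑ i, ∑ j, S i j ^ 2 := by
    rw [norm_sq, mul_div_cancel₀ _ hp0]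
  have h3 : ∀ q, Shrinkage.inner (S * symUnit q) (symUnit q * S)
      = (S q.1 q.1 * S q.2 q.2 + S q.1 q.2 ^ 2) / 2 := by
    rintro ⟨i, j⟩
    have e1 : ∀ a b, (S * symUnit (i, j)) a b = Real.sqrt p / 2 *
        (S a i * (if b = j then 1 else 0) + S a j * (if b = i then 1 else 0)) := by
      intro a b
      simp only [Matrix.mul_apply, symUnit, Matrix.of_apply, mul_add, Finset.sum_add_distrib]
      simp
      split_ifs <;> ring
    have e2 : ∀ a b, (symUnit (i, j) * S) a b = Real.sqrt p / 2 *
        ((if a = i then 1 else 0) * S j b + (if a = j then 1 else 0) * S i b) := by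
      intro a b
      simp only [Matrix.mul_apply, symUnit, Matrix.of_apply, mul_add, add_mul,
        Finset.sum_add_distrib]
      simp
    have hs : Real.sqrt p * Real.sqrt p = p := Real.mul_self_sqrt (Nat.cast_nonneg p)
    have e3 : ∀ a b, (S * symUnit (i, j)) a b * (symUnit (i, j) * S) a b = p / 4 *
        ((if a = i then (if b = j then S a i * S j b else 0) else 0)
          + (if a = j then (if b = j then S a i * S i b else 0) else 0)
          + (if a = i then (if b = i then S a j * S j b else 0) else 0)
          + (if a = j then (if b = i then S a j * S i b else 0) else 0)) := by
      intro a b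
      rw [e1, e2, mul_mul_mul_comm, show Real.sqrt p / 2 * (Real.sqrt p / 2) = (p : ℝ) / 4 by
        rw [div_mul_div_comm, hs]; norm_num]
      congr 1
      split_ifs <;> ring
    rw [inner_eq_sum]
    simp only [e3, ← Finset.mul_sum, Finset.sum_add_distrib, Finset.sum_ite_irrel,
      Finset.sum_ite_eq', Finset.sum_const_zero, Finset.mem_univ, if_true]
    rw [hS.apply i j]
    field_simp
    ring
  simp only [h3, h1, h2, ← Finset.sum_div, Fintype.sum_prod_type, Finset.sum_add_distrib]
  rw [sq (∑ i, S i i), Finset.sum_mul_sum]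
  ring

theorem covKnown_isSymm (m : Fin p → ℝ) (X : Matrix (Fin p) (Fin n) ℝ) :
    (Shrinkage.covKnown m X).IsSymm := by
  simp [Shrinkage.covKnown, Matrix.IsSymm]

theorem covUnknown_isSymm (X : Matrix (Fin p) (Fin n) ℝ) :
    (Shrinkage.covUnknown X).IsSymm := by
  simp [Shrinkage.covUnknown, Matrix.IsSymm]

theorem outer_isSymm (X : Matrix (Fin p) (Fin n) ℝ) (k : Fin n) :
    (Shrinkage.outer X k).IsSymm := by
  ext i j
  simp [Shrinkage.outer, Matrix.vecMulVec_apply, mul_comm]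

theorem vhatKnown_eq_sum (m : Fin p → ℝ) (X : Matrix (Fin p) (Fin n) ℝ) :
    Shrinkage.vhatKnown m X = ∑ q, Shrinkage.vhatTargetKnown m (symUnit q) X := by
  have h : ∀ k, (Shrinkage.outer (Shrinkage.centerAt m X) k - Shrinkage.covKnown m X).IsSymm :=
    fun k => (outer_isSymm _ k).sub (covKnown_isSymm m X)
  simp only [Shrinkage.vhatKnown, Shrinkage.vhatTargetKnown, norm_sq_eq_sum_symUnit (h _)]
  rw [Finset.sum_comm, Finset.mul_sum]
  refine Finset.sum_congr rfl fun q _ => ?_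
  rw [← Finset.sum_div]
  ring

/-- Parseval expands `bbar` and ‖S‖² over the frame, and `sum_inner_mul_symUnit`, solved for the
trace term, expands that one. The identity then holds for each frame element separately. -/
theorem vhatUnknown_eq_sum (hp : 1 ≤ p) (hn : 4 ≤ n) (x : Fin n → Fin p → ℝ) :
    Shrinkage.vhatUnknown (ofCols x)
      = ∑ q, Shrinkage.vhatTargetUnknown (symUnit q) (ofCols x) := by
  have hn' : (4 : ℝ) ≤ n := by exact_mod_cast hn
  have hn0 : (n : ℝ) ≠ 0 := by positivity
  have hn1 : (n : ℝ) - 1 ≠ 0 := by linarith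
  have hn2 : (n : ℝ) - 2 ≠ 0 := by linarith
  have hn3 : (n : ℝ) - 3 ≠ 0 := by linarith
  have hp0 : (p : ℝ) ≠ 0 := by positivity
  set S := Shrinkage.covUnknown (ofCols x) with hS
  set w : Fin n → Fin p × Fin p → ℝ := fun k q =>
    Shrinkage.inner (Shrinkage.outer (Shrinkage.centerEmp (ofCols x)) k) (symUnit q) with hw
  have hsw : ∀ q, ∑ k, w k q = (n - 1) * Shrinkage.inner S (symUnit q) := by
    intro q
    rw [hS, inner_covUnknown_ofCols, hw]
    simp only [centerEmp_ofCols, outer_ofCols, inner_vecMulVec, ← Finset.sum_div]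
    field_simp
  have hsymm : ∀ k, (((n : ℝ) / ((n : ℝ) - 1)) •
      Shrinkage.outer (Shrinkage.centerEmp (ofCols x)) k - S).IsSymm :=
    fun k => ((outer_isSymm _ k).smul _).sub (covUnknown_isSymm _)
  have hb : Shrinkage.bbar (ofCols x) = ∑ q, (1 / ((n : ℝ) - 1) ^ 2 * ∑ k, w k q ^ 2
      - 1 / n * Shrinkage.inner S (symUnit q) ^ 2) := by
    simp only [Shrinkage.bbar, ← hS, norm_sq_eq_sum_symUnit (hsymm _)]
    rw [Finset.sum_comm, Finset.mul_sum]
    refine Finset.sum_congr rfl fun q _ => ?_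
    have e : ∀ k, Shrinkage.inner (((n : ℝ) / ((n : ℝ) - 1)) •
        Shrinkage.outer (Shrinkage.centerEmp (ofCols x)) k - S) (symUnit q) ^ 2
        = (n / (n - 1)) ^ 2 * w k q ^ 2
          - 2 * (n / (n - 1)) * Shrinkage.inner S (symUnit q) * w k q
          + Shrinkage.inner S (symUnit q) ^ 2 := by
      intro k
      rw [inner_sub_left, inner_smul_left]
      ring
    simp only [e, Finset.sum_add_distrib, Finset.sum_sub_distrib, ← Finset.mul_sum, hsw,
      Finset.sum_const, Finset.card_univ, Fintype.card_fin, nsmul_eq_mul]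
    field_simp
    ring
  have hN : Shrinkage.norm S ^ 2 = ∑ q, Shrinkage.inner S (symUnit q) ^ 2 :=
    norm_sq_eq_sum_symUnit (covUnknown_isSymm _)
  have hI : (p : ℝ) * Shrinkage.inner S 1 ^ 2 = ∑ q, (2 / (p : ℝ) *
      Shrinkage.inner (S * symUnit q) (symUnit q * S) - Shrinkage.inner S (symUnit q) ^ 2) := by
    rw [Finset.sum_sub_distrib, ← Finset.mul_sum, sum_inner_mul_symUnit (covUnknown_isSymm _), ← hN]
    field_simp
    ring
  rw [Shrinkage.vhatUnknown, ← hS, hb, hI, hN, Finset.mul_sum, Finset.mul_sum, Finset.mul_sum,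
    ← Finset.sum_sub_distrib, ← Finset.sum_sub_distrib]
  refine Finset.sum_congr rfl fun q _ => ?_
  rw [Shrinkage.vhatTargetUnknown, Shrinkage.bbarTarget, ← hS]
  change _ = (n - 1 : ℝ) ^ 2 / (p * (n - 2) * (n - 3)) * (p / (n - 1) ^ 2 * ∑ k, w k q ^ 2
    - 1 / n * Shrinkage.inner (S * symUnit q) (symUnit q * S)) + _ - _
  generalize ∑ k, w k q ^ 2 = A
  generalize Shrinkage.inner (S * symUnit q) (symUnit q * S) = R
  generalize Shrinkage.inner S (symUnit q) = s
  field_simp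
  ring

end Frames

end UStat

namespace UStat

/-! ### Unbiasedness and error bounds for a centered sample. -/

section Sample

/-- A sample `φ` of centered vectors with covariance `S` and bounded eighth moment. -/
structure IsCenteredSample {Ω : Type*} [MeasurableSpace Ω] {p n : ℕ} (P : Measure Ω)
    (φ : Ω → Fin n → Fin p → ℝ) (ρ : Measure (Fin p → ℝ)) (S : Matrix (Fin p) (Fin p) ℝ)
    (M : ℝ) : Prop where
  isProb : IsProbabilityMeasure ρ
  law : HasLaw φ (Measure.pi fun _ => ρ) P
  mean : ∀ i, ∫ x, x i ∂ρ = 0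
  integrable : Integrable (fun u => (u ⬝ᵥ u) ^ 4) ρ
  moment_le : ∫ u, (u ⬝ᵥ u) ^ 4 ∂ρ ≤ M
  isSymm : S.IsSymm
  inner_eq : ∀ T, Shrinkage.inner S T = formMean T ρ / p

variable {Ω : Type*} [MeasurableSpace Ω] {p n : ℕ} {P : Measure Ω}
  {φ : Ω → Fin n → Fin p → ℝ} {ρ : Measure (Fin p → ℝ)} {S : Matrix (Fin p) (Fin p) ℝ} {M : ℝ}

theorem _root_.ProbabilityTheory.HasLaw.memLp_comp {α : Type*} [MeasurableSpace α]
    {μ : Measure α} {X : Ω → α} (hX : HasLaw X μ P) {f : α → ℝ} {q : ENNReal}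
    (hf : MemLp f q μ) : MemLp (fun ω => f (X ω)) q P := by
  rw [← hX.map_eq] at hf
  exact hf.comp_of_map hX.aemeasurable

theorem _root_.ProbabilityTheory.HasLaw.integrable_comp {α : Type*} [MeasurableSpace α]
    {μ : Measure α} {X : Ω → α} (hX : HasLaw X μ P) {f : α → ℝ}
    (hf : Integrable f μ) : Integrable (fun ω => f (X ω)) P := by
  rw [← memLp_one_iff_integrable] at hf ⊢
  exact hX.memLp_comp hf

theorem IsCenteredSample.memLp (h : IsCenteredSample P φ ρ S M) (i : Fin p) :
    MemLp (fun x => x i) 4 ρ :=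
  have := h.isProb
  memLp_four_of_integrable ρ h.integrable i

/-- Transport of a statement on an unbiased U-statistic from the product space. -/
theorem IsCenteredSample.unbiased_of_kernel (h : IsCenteredSample P φ ρ S M) {m : ℕ} (hmn : m ≤ n)
    {g : (Fin m → Fin p → ℝ) → ℝ} {D : (Fin n → Fin p → ℝ) → ℝ}
    (hg : Integrable g (Measure.pi fun _ => ρ)) (hD : MemLp D 2 (Measure.pi fun _ => ρ))
    (hgD : ∫ z, g z ∂(Measure.pi fun _ => ρ) = ∫ x, D x ^ 2 ∂(Measure.pi fun _ => ρ)) :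
    Integrable (fun ω => D (φ ω) ^ 2) P ∧
    Shrinkage.IsUnbiased P (fun ω => average g (φ ω)) (∫ ω, D (φ ω) ^ 2 ∂P) := by
  have := h.isProb
  have hi : Integrable (average (n := n) g) (Measure.pi fun _ => ρ) := by
    rw [← memLp_one_iff_integrable] at hg ⊢
    exact memLp_average ρ hg
  refine ⟨h.law.integrable_comp hD.integrable_sq, h.law.integrable_comp hi, ?_⟩
  rw [← integral_average (n := n) ρ hmn hg] at hgD
  have e1 := h.law.integral_comp hi.aestronglyMeasurable
  have e2 := h.law.integral_comp hD.integrable_sq.aestronglyMeasurable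
  exact e1.trans (hgD.trans e2.symm)

theorem IsCenteredSample.knownTarget (h : IsCenteredSample P φ ρ S M) (hn : 2 ≤ n)
    {T : Matrix (Fin p) (Fin p) ℝ} (hT : T.IsSymm) :
    Integrable (fun ω => Shrinkage.inner (Shrinkage.covKnown 0 (ofCols (φ ω)) - S) T ^ 2) P ∧
    Shrinkage.IsUnbiased P (fun ω => Shrinkage.vhatTargetKnown 0 T (ofCols (φ ω)))
      (Shrinkage.varianceTarget P (fun ω => Shrinkage.covKnown 0 (ofCols (φ ω))) S T) := by
  have := h.isProb
  obtain ⟨hD, hV⟩ := integral_inner_covKnown_sub_sq (n := n) ρ (by omega) hT h.memLp h.mean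
    (h.inner_eq T)
  obtain ⟨hg, hE⟩ := integral_kernelKnown (n := n) (T := T) ρ h.memLp
  simp only [vhatTargetKnown_eq_average hn]
  exact h.unbiased_of_kernel hn hg hD (hE.trans hV.symm)

theorem IsCenteredSample.unknownTarget (h : IsCenteredSample P φ ρ S M) (hp : 1 ≤ p) (hn : 4 ≤ n)
    {T : Matrix (Fin p) (Fin p) ℝ} (hT : T.IsSymm) :
    Integrable (fun ω => Shrinkage.inner (Shrinkage.covUnknown (ofCols (φ ω)) - S) T ^ 2) P ∧
    Shrinkage.IsUnbiased P (fun ω => Shrinkage.vhatTargetUnknown T (ofCols (φ ω)))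
      (Shrinkage.varianceTarget P (fun ω => Shrinkage.covUnknown (ofCols (φ ω))) S T) := by
  have := h.isProb
  obtain ⟨hD, hV⟩ := integral_inner_covUnknown_sub_sq (n := n) ρ (by omega) hT h.memLp h.mean
    (h.inner_eq T)
  obtain ⟨hg, hE⟩ := integral_kernelUnknown (n := n) ρ (by omega) hT h.memLp h.mean
  simp only [vhatTargetUnknown_eq_average hp hn hT]
  exact h.unbiased_of_kernel hn hg hD (hE.trans hV.symm)

variable {ι : Type*} [Fintype ι]

theorem average_sum {m : ℕ} (g : ι → (Fin m → Fin p → ℝ) → ℝ) (x : Fin n → Fin p → ℝ) :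
    ∑ τ, average (g τ) x = average (fun z => ∑ τ, g τ z) x := by
  simp only [average, ← Finset.mul_sum]
  rw [Finset.sum_comm]

/-- Square integrability and variance of a sum of U-statistics whose kernels have fourth order
growth. -/
theorem IsCenteredSample.sum_sub_sq_le (h : IsCenteredSample P φ ρ S M) {m : ℕ} (hmn : m ≤ n)
    (hn : 1 ≤ n) {g : ι → (Fin m → Fin p → ℝ) → ℝ} {V : ι → ℝ} {c : ℝ}
    (hgm : ∀ τ, Measurable (g τ)) (hgi : ∀ τ, Integrable (g τ) (Measure.pi fun _ => ρ))
    (hle : ∀ z, |∑ τ, g τ z| ≤ c * ∑ i, (z i ⬝ᵥ z i) ^ 2)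
    (hV : ∀ τ, Shrinkage.IsUnbiased P (fun ω => average (g τ) (φ ω)) (V τ)) :
    MemLp (fun ω => ∑ τ, (average (g τ) (φ ω) - V τ)) 2 P ∧
    ∫ ω, (∑ τ, (average (g τ) (φ ω) - V τ)) ^ 2 ∂P ≤ (m : ℝ) ^ 2 / n * (c ^ 2 * m ^ 2 * M) := by
  have := h.isProb
  have hGm : Measurable fun z => ∑ τ, g τ z := Finset.measurable_fun_sum _ fun τ _ => hgm τ
  obtain ⟨hG, hG2⟩ := memLp_of_abs_le ρ hGm h.integrable hle
  -- Unbiasedness identifies each `V τ` as a kernel mean, so the total error is that of a single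
  -- U-statistic with the summed kernel.
  have hVg : ∀ τ, V τ = ∫ z, g τ z ∂(Measure.pi fun _ => ρ) := by
    intro τ
    have hi : Integrable (average (n := n) (g τ)) (Measure.pi fun _ => ρ) := by
      have := hgi τ
      rw [← memLp_one_iff_integrable] at this ⊢
      exact memLp_average ρ this
    rw [← (hV τ).2, ← integral_average (n := n) ρ hmn (hgi τ)]
    exact h.law.integral_comp hi.aestronglyMeasurable
  have e : ∀ x : Fin n → Fin p → ℝ, ∑ τ, (average (g τ) x - V τ)
      = average (fun z => ∑ τ, g τ z) x - ∫ z, ∑ τ, g τ z ∂(Measure.pi fun _ => ρ) := by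
    intro x
    rw [Finset.sum_sub_distrib, average_sum, integral_finsetSum _ fun τ _ => hgi τ]
    simp only [hVg]
  have hL : MemLp (fun x : Fin n → Fin p → ℝ => ∑ τ, (average (g τ) x - V τ)) 2
      (Measure.pi fun _ => ρ) := by
    simp only [e]
    exact (memLp_average ρ hG).sub (memLp_const _)
  refine ⟨h.law.memLp_comp hL, ?_⟩
  have e2 := h.law.integral_comp hL.integrable_sq.aestronglyMeasurable
  refine le_trans (le_of_eq e2) ?_
  simp only [e]
  refine (integral_average_sub_sq_le ρ hmn hn hG).trans ?_
  gcongr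
  refine hG2.trans ?_
  gcongr
  exact h.moment_le

variable {T : ι → Matrix (Fin p) (Fin p) ℝ}

theorem measurable_kernelKnown (T : Matrix (Fin p) (Fin p) ℝ) : Measurable (kernelKnown n T) := by
  have d := fun i : Fin 2 => measurable_pi_apply (X := fun _ => Fin p → ℝ) i
  have b := fun i : Fin 2 => measurable_bilin (T := T) (d i) (d i)
  exact (((b 0).sub (b 1)).pow_const 2).div_const _

theorem measurable_kernelUnknown (T : Matrix (Fin p) (Fin p) ℝ) :
    Measurable (kernelUnknown n T) := by
  have d := fun i j : Fin 4 => (measurable_pi_apply (X := fun _ => Fin p → ℝ) i).sub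
    (measurable_pi_apply j)
  have b := fun i j k l : Fin 4 => measurable_bilin (T := T) (d i j) (d k l)
  exact (((((b 0 1 0 1).pow_const 2).sub ((b 0 1 0 1).mul (b 2 3 2 3))).const_mul _).sub
    (((b 0 1 2 3).pow_const 2).const_mul _)).div_const _

theorem IsCenteredSample.knownTarget_sum (h : IsCenteredSample P φ ρ S M) (hp : 1 ≤ p) (hn : 2 ≤ n)
    (hT : ∀ τ, (T τ).IsSymm) (hB : IsBessel T) :
    MemLp (fun ω => ∑ τ, (Shrinkage.vhatTargetKnown 0 (T τ) (ofCols (φ ω)) -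
      Shrinkage.varianceTarget P (fun ω => Shrinkage.covKnown 0 (ofCols (φ ω))) S (T τ))) 2 P ∧
    ∫ ω, (∑ τ, (Shrinkage.vhatTargetKnown 0 (T τ) (ofCols (φ ω)) -
      Shrinkage.varianceTarget P (fun ω => Shrinkage.covKnown 0 (ofCols (φ ω))) S (T τ))) ^ 2 ∂P
      ≤ 16384 * M / (n ^ 3 * p ^ 2) := by
  have := h.isProb
  have hV := fun τ => (h.knownTarget hn (hT τ)).2
  simp only [vhatTargetKnown_eq_average hn] at hV ⊢
  have hM : 0 ≤ M := (integral_nonneg fun u => by positivity).trans h.moment_le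
  obtain ⟨h1, h2⟩ := h.sum_sub_sq_le hn (by omega) (fun τ => measurable_kernelKnown (n := n) (T τ))
    (fun τ => (integral_kernelKnown ρ h.memLp).1) (abs_sum_kernelKnown_le hB hp) hV
  refine ⟨h1, h2.trans ?_⟩
  -- Here m = 2 and c = 1/(np), so m⁴c² = 16/(n²p²). The bound is relaxed to the constant of the
  -- unknown mean so that both settings share it.
  calc _ = 16 * M / (n ^ 3 * p ^ 2) := by
        push_cast
        field_simp
        ring
    _ ≤ _ := by gcongr; norm_num

theorem IsCenteredSample.unknownTarget_sum (h : IsCenteredSample P φ ρ S M) (hp : 1 ≤ p)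
    (hn : 4 ≤ n) (hT : ∀ τ, (T τ).IsSymm) (hB : IsBessel T) :
    MemLp (fun ω => ∑ τ, (Shrinkage.vhatTargetUnknown (T τ) (ofCols (φ ω)) -
      Shrinkage.varianceTarget P (fun ω => Shrinkage.covUnknown (ofCols (φ ω))) S (T τ))) 2 P ∧
    ∫ ω, (∑ τ, (Shrinkage.vhatTargetUnknown (T τ) (ofCols (φ ω)) -
      Shrinkage.varianceTarget P (fun ω => Shrinkage.covUnknown (ofCols (φ ω))) S (T τ))) ^ 2 ∂P
      ≤ 16384 * M / (n ^ 3 * p ^ 2) := by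
  have := h.isProb
  have hV := fun τ => (h.unknownTarget hp hn (hT τ)).2
  simp only [fun τ => vhatTargetUnknown_eq_average hp hn (hT τ)] at hV ⊢
  obtain ⟨h1, h2⟩ := h.sum_sub_sq_le hn (by omega)
    (fun τ => measurable_kernelUnknown (n := n) (T τ))
    (fun τ => (integral_kernelUnknown ρ (by omega) (hT τ) h.memLp h.mean).1)
    (abs_sum_kernelUnknown_le hB hp (by omega)) hV
  -- Here m = 4 and c = 8/(np), and 4⁴ · 8² = 16384.
  refine ⟨h1, h2.trans (le_of_eq ?_)⟩
  push_cast
  field_simp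
  ring

/-- Parseval applies to the symmetric matrix C - S, so the whole-matrix statements are sums of
target statements over the frame. -/
theorem IsCenteredSample.sum_symUnit (h : IsCenteredSample P φ ρ S M)
    {C : Ω → Matrix (Fin p) (Fin p) ℝ} {v : Ω → ℝ} {w : Fin p × Fin p → Ω → ℝ}
    (hC : ∀ ω, (C ω).IsSymm) (hv : ∀ ω, v ω = ∑ q, w q ω)
    (hint : ∀ q, Integrable (fun ω => Shrinkage.inner (C ω - S) (symUnit q) ^ 2) P)
    (hunb : ∀ q, Shrinkage.IsUnbiased P (w q) (Shrinkage.varianceTarget P C S (symUnit q))) :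
    Integrable (fun ω => Shrinkage.norm (C ω - S) ^ 2) P ∧
    Shrinkage.variance P C S = ∑ q, Shrinkage.varianceTarget P C S (symUnit q) ∧
    Shrinkage.IsUnbiased P v (Shrinkage.variance P C S) := by
  have e : ∀ ω, Shrinkage.norm (C ω - S) ^ 2 = ∑ q, Shrinkage.inner (C ω - S) (symUnit q) ^ 2 :=
    fun ω => norm_sq_eq_sum_symUnit ((hC ω).sub h.isSymm)
  have hvar : Shrinkage.variance P C S
      = ∑ q, Shrinkage.varianceTarget P C S (symUnit q) := by
    simp only [Shrinkage.variance, Shrinkage.varianceTarget, e]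
    rw [integral_finsetSum _ fun q _ => hint q]
  refine ⟨?_, hvar, ?_, ?_⟩
  · simp only [e]
    exact integrable_finsetSum _ fun q _ => hint q
  · simp only [funext hv]
    exact integrable_finsetSum _ fun q _ => (hunb q).1
  · simp only [hv]
    rw [integral_finsetSum _ fun q _ => (hunb q).1, hvar]
    exact Finset.sum_congr rfl fun q _ => (hunb q).2

theorem IsCenteredSample.known (h : IsCenteredSample P φ ρ S M) (hp : 1 ≤ p) (hn : 2 ≤ n) :
    (Integrable (fun ω => Shrinkage.norm (Shrinkage.covKnown 0 (ofCols (φ ω)) - S) ^ 2) P ∧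
    Shrinkage.IsUnbiased P (fun ω => Shrinkage.vhatKnown 0 (ofCols (φ ω)))
      (Shrinkage.variance P (fun ω => Shrinkage.covKnown 0 (ofCols (φ ω))) S)) ∧
    MemLp (fun ω => Shrinkage.vhatKnown 0 (ofCols (φ ω)) -
      Shrinkage.variance P (fun ω => Shrinkage.covKnown 0 (ofCols (φ ω))) S) 2 P ∧
    ∫ ω, (Shrinkage.vhatKnown 0 (ofCols (φ ω)) -
      Shrinkage.variance P (fun ω => Shrinkage.covKnown 0 (ofCols (φ ω))) S) ^ 2 ∂P
      ≤ 16384 * M / (n ^ 3 * p ^ 2) := by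
  have ht := fun q => h.knownTarget hn (symUnit_isSymm q)
  obtain ⟨h1, h2, h3⟩ := h.sum_symUnit (fun ω => covKnown_isSymm 0 (ofCols (φ ω)))
    (fun ω => vhatKnown_eq_sum 0 (ofCols (φ ω))) (fun q => (ht q).1) fun q => (ht q).2
  refine ⟨⟨h1, h3⟩, ?_⟩
  have := h.knownTarget_sum hp hn symUnit_isSymm isBessel_symUnit
  simp only [Finset.sum_sub_distrib, ← vhatKnown_eq_sum, ← h2] at this
  exact this

theorem IsCenteredSample.unknown (h : IsCenteredSample P φ ρ S M) (hp : 1 ≤ p) (hn : 4 ≤ n) :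
    (Integrable (fun ω => Shrinkage.norm (Shrinkage.covUnknown (ofCols (φ ω)) - S) ^ 2) P ∧
    Shrinkage.IsUnbiased P (fun ω => Shrinkage.vhatUnknown (ofCols (φ ω)))
      (Shrinkage.variance P (fun ω => Shrinkage.covUnknown (ofCols (φ ω))) S)) ∧
    MemLp (fun ω => Shrinkage.vhatUnknown (ofCols (φ ω)) -
      Shrinkage.variance P (fun ω => Shrinkage.covUnknown (ofCols (φ ω))) S) 2 P ∧
    ∫ ω, (Shrinkage.vhatUnknown (ofCols (φ ω)) -
      Shrinkage.variance P (fun ω => Shrinkage.covUnknown (ofCols (φ ω))) S) ^ 2 ∂P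
      ≤ 16384 * M / (n ^ 3 * p ^ 2) := by
  have ht := fun q => h.unknownTarget hp hn (symUnit_isSymm q)
  obtain ⟨h1, h2, h3⟩ := h.sum_symUnit (fun ω => covUnknown_isSymm (ofCols (φ ω)))
    (fun ω => vhatUnknown_eq_sum hp hn (φ ω)) (fun q => (ht q).1) fun q => (ht q).2
  refine ⟨⟨h1, h3⟩, ?_⟩
  have := h.unknownTarget_sum hp hn symUnit_isSymm isBessel_symUnit
  simp only [Finset.sum_sub_distrib, ← vhatUnknown_eq_sum hp hn, ← h2] at this
  exact this

end Sample

end UStat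

namespace UStat

/-! ### Reduction to centered observations and control of their eighth moment. -/

section Centering

variable {p n : ℕ}

theorem dotProduct_self_orthogonal {G : Matrix (Fin p) (Fin p) ℝ}
    (hG : G ∈ Matrix.orthogonalGroup (Fin p) ℝ) (x : Fin p → ℝ) :
    (Gᵀ *ᵥ x) ⬝ᵥ (Gᵀ *ᵥ x) = x ⬝ᵥ x := by
  have h : G * Gᵀ = 1 := by
    simpa [Matrix.star_eq_conjTranspose] using Matrix.mem_orthogonalGroup_iff (Fin p) ℝ |>.1 hG
  rw [Matrix.dotProduct_mulVec, Matrix.vecMul_transpose, Matrix.mulVec_mulVec, h,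
    Matrix.one_mulVec]

/-- Rotation by Gᵀ preserves the norm, and the power mean inequality gives (∑ yᵢ²)⁴ ≤ p³ ∑ yᵢ⁸; the
averaged moment bound supplies the fourth factor p. -/
theorem integral_dotProduct_self_pow_le (ν : Measure (Fin p → ℝ)) (hp : 1 ≤ p)
    {G : Matrix (Fin p) (Fin p) ℝ} (hG : G ∈ Matrix.orthogonalGroup (Fin p) ℝ) {K : ℝ}
    (hi : ∀ i, Integrable (fun x => (Gᵀ *ᵥ x) i ^ 8) ν)
    (hK : 1 / (p : ℝ) * ∑ i, ∫ x, (Gᵀ *ᵥ x) i ^ 8 ∂ν ≤ K) :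
    Integrable (fun u => (u ⬝ᵥ u) ^ 4) ν ∧ ∫ u, (u ⬝ᵥ u) ^ 4 ∂ν ≤ K * p ^ 4 := by
  have hp0 : (0 : ℝ) < p := by exact_mod_cast hp
  have hle : ∀ u : Fin p → ℝ, (u ⬝ᵥ u) ^ 4 ≤ p ^ 3 * ∑ i, (Gᵀ *ᵥ u) i ^ 8 := by
    intro u
    have h := pow_sum_le_card_mul_sum_pow (s := Finset.univ)
      (f := fun i => (Gᵀ *ᵥ u) i * (Gᵀ *ᵥ u) i) (fun i _ => mul_self_nonneg _) 3
    rw [← dotProduct_self_orthogonal hG u]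
    refine h.trans (le_of_eq ?_)
    rw [Finset.card_univ, Fintype.card_fin]
    congr 1
    exact Finset.sum_congr rfl fun i _ => by ring
  have hb : Integrable (fun u => (p : ℝ) ^ 3 * ∑ i, (Gᵀ *ᵥ u) i ^ 8) ν :=
    (integrable_finsetSum _ fun i _ => hi i).const_mul _
  have hI : Integrable (fun u => (u ⬝ᵥ u) ^ 4) ν :=
    hb.mono' (measurable_dotProduct_self.pow_const 4).aestronglyMeasurable (ae_of_all _ fun u => by
      rw [Real.norm_of_nonneg (by positivity)]
      exact hle u)
  refine ⟨hI, (integral_mono hI hb hle).trans ?_⟩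
  rw [integral_const_mul, integral_finsetSum _ fun i _ => hi i]
  rw [one_div, inv_mul_le_iff₀ hp0] at hK
  calc _ ≤ (p : ℝ) ^ 3 * (p * K) := by gcongr
    _ = _ := by ring

theorem sq_integral_le {α : Type*} [MeasurableSpace α] (ν : Measure α) [IsProbabilityMeasure ν]
    {f : α → ℝ} (hf : MemLp f 2 ν) : (∫ x, f x ∂ν) ^ 2 ≤ ∫ x, f x ^ 2 ∂ν := by
  have h := ProbabilityTheory.variance_nonneg f ν
  rw [ProbabilityTheory.variance_eq_sub hf] at h
  simpa using h

/-- Jensen's inequality for the square, used three times: on each coordinate, on |u|² and on |u|⁴.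
-/
theorem dotProduct_popMean_le (ν : Measure (Fin p → ℝ)) [IsProbabilityMeasure ν]
    (hI : Integrable (fun u => (u ⬝ᵥ u) ^ 4) ν) :
    (Shrinkage.popMean ν ⬝ᵥ Shrinkage.popMean ν) ^ 4 ≤ ∫ u, (u ⬝ᵥ u) ^ 4 ∂ν := by
  have hL := memLp_four_of_integrable ν hI
  have hL2 : ∀ i, MemLp (fun x : Fin p → ℝ => x i) 2 ν := fun i =>
    (hL i).mono_exponent (by norm_num)
  have hi : ∀ i, Integrable (fun x : Fin p → ℝ => x i * x i) ν := fun i =>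
    (hL2 i).integrable_mul (hL2 i)
  have h4 : MemLp (fun u : Fin p → ℝ => (u ⬝ᵥ u) ^ 2) 2 ν := by
    rw [memLp_two_iff_integrable_sq
      (measurable_dotProduct_self.pow_const 2).aestronglyMeasurable]
    simpa only [← pow_mul] using hI
  have h2 : MemLp (fun u : Fin p → ℝ => u ⬝ᵥ u) 2 ν := by
    rw [memLp_two_iff_integrable_sq measurable_dotProduct_self.aestronglyMeasurable]
    exact h4.integrable (by norm_num)
  have a1 : Shrinkage.popMean ν ⬝ᵥ Shrinkage.popMean ν ≤ ∫ u, u ⬝ᵥ u ∂ν := by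
    simp only [dotProduct]
    rw [integral_finsetSum _ fun i _ => hi i]
    refine Finset.sum_le_sum fun i _ => ?_
    have := sq_integral_le ν (hL2 i)
    simp only [sq] at this
    exact this
  have a2 := sq_integral_le ν h2
  have a3 := sq_integral_le ν h4
  simp only [← pow_mul] at a3
  have b0 := dotProduct_self_nonneg' (Shrinkage.popMean ν)
  calc (Shrinkage.popMean ν ⬝ᵥ Shrinkage.popMean ν) ^ 4 ≤ (∫ u, u ⬝ᵥ u ∂ν) ^ 4 := by gcongr
    _ = ((∫ u, u ⬝ᵥ u ∂ν) ^ 2) ^ 2 := by ring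
    _ ≤ (∫ u, (u ⬝ᵥ u) ^ 2 ∂ν) ^ 2 := by gcongr
    _ ≤ _ := a3

/-- The law of the observations minus their mean. -/
noncomputable def centeredLaw (ν : Measure (Fin p → ℝ)) : Measure (Fin p → ℝ) :=
  ν.map fun x => x - Shrinkage.popMean ν

theorem measurable_sub_popMean (ν : Measure (Fin p → ℝ)) :
    Measurable fun x : Fin p → ℝ => x - Shrinkage.popMean ν :=
  measurable_id.sub_const _

theorem dotProduct_self_sub_pow_le (u v : Fin p → ℝ) :
    ((u - v) ⬝ᵥ (u - v)) ^ 4 ≤ 128 * ((u ⬝ᵥ u) ^ 4 + (v ⬝ᵥ v) ^ 4) := by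
  have h1 := sq_dotProduct_self_sub_le u v
  calc ((u - v) ⬝ᵥ (u - v)) ^ 4 = (((u - v) ⬝ᵥ (u - v)) ^ 2) ^ 2 := by ring
    _ ≤ (8 * ((u ⬝ᵥ u) ^ 2 + (v ⬝ᵥ v) ^ 2)) ^ 2 := by gcongr
    -- 128 = 2 · 8², from (a + b)² ≤ 2(a² + b²).
    _ ≤ _ := by nlinarith [sq_nonneg ((u ⬝ᵥ u) ^ 2 - (v ⬝ᵥ v) ^ 2)]

theorem centeredLaw_moment (ν : Measure (Fin p → ℝ)) [IsProbabilityMeasure ν]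
    (hI : Integrable (fun u => (u ⬝ᵥ u) ^ 4) ν) :
    Integrable (fun u => (u ⬝ᵥ u) ^ 4) (centeredLaw ν) ∧
    ∫ u, (u ⬝ᵥ u) ^ 4 ∂(centeredLaw ν) ≤ 256 * ∫ u, (u ⬝ᵥ u) ^ 4 ∂ν := by
  have hm := measurable_sub_popMean ν
  have hq : Measurable fun u : Fin p → ℝ => (u ⬝ᵥ u) ^ 4 := measurable_dotProduct_self.pow_const 4
  have hb : Integrable (fun u => 128 * ((u ⬝ᵥ u) ^ 4
      + (Shrinkage.popMean ν ⬝ᵥ Shrinkage.popMean ν) ^ 4)) ν :=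
    (hI.add (integrable_const _)).const_mul _
  have hI' : Integrable (fun u => ((u - Shrinkage.popMean ν) ⬝ᵥ (u - Shrinkage.popMean ν)) ^ 4) ν :=
    hb.mono' (hq.comp hm).aestronglyMeasurable (ae_of_all _ fun u => by
      rw [Real.norm_of_nonneg (by positivity)]
      exact dotProduct_self_sub_pow_le _ _)
  constructor
  · exact (integrable_map_measure hq.aestronglyMeasurable hm.aemeasurable).2 hI'
  · rw [centeredLaw, integral_map hm.aemeasurable hq.aestronglyMeasurable]
    refine (integral_mono hI' hb fun u => dotProduct_self_sub_pow_le _ _).trans ?_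
    rw [integral_const_mul, integral_add hI (integrable_const _)]
    have := dotProduct_popMean_le ν hI
    simp only [integral_const, probReal_univ, one_smul]
    linarith

theorem centeredLaw_mean (ν : Measure (Fin p → ℝ)) [IsProbabilityMeasure ν]
    (hL : ∀ i, Integrable (fun x : Fin p → ℝ => x i) ν) (i : Fin p) :
    ∫ x, x i ∂(centeredLaw ν) = 0 := by
  rw [centeredLaw, integral_map (measurable_sub_popMean ν).aemeasurable
    (measurable_pi_apply i).aestronglyMeasurable]
  simp only [Pi.sub_apply]
  rw [integral_sub (hL i) (integrable_const _)]
  simp [Shrinkage.popMean]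

theorem inner_popCov (ν : Measure (Fin p → ℝ)) [IsProbabilityMeasure ν]
    (hL : ∀ i, MemLp (fun x : Fin p → ℝ => x i) 2 ν) (T : Matrix (Fin p) (Fin p) ℝ) :
    Shrinkage.inner (Shrinkage.popCov ν) T = formMean T (centeredLaw ν) / p := by
  have hb : Measurable fun u : Fin p → ℝ => bilin T u u :=
    measurable_bilin measurable_id measurable_id
  have hL' : ∀ i, MemLp (fun x : Fin p → ℝ => x i - Shrinkage.popMean ν i) 2 ν := fun i =>
    (hL i).sub (memLp_const _)
  have hi : ∀ i j, Integrable (fun x : Fin p → ℝ => T i j *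
      ((x i - Shrinkage.popMean ν i) * (x j - Shrinkage.popMean ν j))) ν := fun i j =>
    ((hL' i).integrable_mul (hL' j)).const_mul _
  rw [inner_eq_sum, formMean, centeredLaw, integral_map (measurable_sub_popMean ν).aemeasurable
    hb.aestronglyMeasurable]
  congr 1
  simp only [bilin_eq_sum, Pi.sub_apply]
  rw [integral_finsetSum _ fun i _ => integrable_finsetSum _ fun j _ => hi i j]
  refine Finset.sum_congr rfl fun i _ => ?_
  rw [integral_finsetSum _ fun j _ => hi i j]
  refine Finset.sum_congr rfl fun j _ => ?_
  rw [integral_const_mul, mul_comm]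
  rfl

theorem popCov_isSymm (ν : Measure (Fin p → ℝ)) : (Shrinkage.popCov ν).IsSymm := by
  ext i j
  simp only [Shrinkage.popCov, Matrix.transpose_apply, Matrix.of_apply]
  exact covariance_comm _ _

variable {Ω : Type*}

/-- The observations minus the population mean, listed by columns. -/
noncomputable def centeredCols (ν : Measure (Fin p → ℝ)) (X : Ω → Matrix (Fin p) (Fin n) ℝ)
    (ω : Ω) (k : Fin n) : Fin p → ℝ :=
  (fun i => X ω i k) - Shrinkage.popMean ν

theorem isCenteredSample_centeredCols [MeasurableSpace Ω] {P : Measure Ω}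
    [IsProbabilityMeasure P] {ν : Measure (Fin p → ℝ)}
    {X : Ω → Matrix (Fin p) (Fin n) ℝ} (hX : Shrinkage.IsIIDSample P X ν) (hn : 1 ≤ n)
    {M : ℝ} (hI : Integrable (fun u => (u ⬝ᵥ u) ^ 4) ν) (hM : ∫ u, (u ⬝ᵥ u) ^ 4 ∂ν ≤ M) :
    IsCenteredSample P (centeredCols ν X) (centeredLaw ν) (Shrinkage.popCov ν) (256 * M) := by
  -- That `ν` has mass one is read off a column, which exists since n ≥ 1.
  have hν : IsProbabilityMeasure ν := (hX.1 ⟨0, hn⟩).isProbabilityMeasure_iff.1 inferInstance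
  have hm := measurable_sub_popMean ν
  have hL := memLp_four_of_integrable ν hI
  have hlaw : HasLaw (fun x : Fin p → ℝ => x - Shrinkage.popMean ν) (centeredLaw ν) ν :=
    ⟨hm.aemeasurable, rfl⟩
  have hcol : ∀ k, HasLaw (fun ω => centeredCols ν X ω k) (centeredLaw ν) P := fun k =>
    hlaw.comp (hX.1 k)
  have hind : iIndepFun (fun k ω => centeredCols ν X ω k) P := hX.2.comp _ fun _ => hm
  obtain ⟨h1, h2⟩ := centeredLaw_moment ν hI
  exact
    { isProb := Measure.isProbabilityMeasure_map hm.aemeasurable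
      law := hind.hasLaw_pi hcol
      mean := centeredLaw_mean ν fun i => (hL i).integrable (by norm_num)
      integrable := h1
      moment_le := h2.trans (by linarith)
      isSymm := popCov_isSymm ν
      inner_eq := inner_popCov ν fun i => (hL i).mono_exponent (by norm_num) }

theorem centerAt_popMean (ν : Measure (Fin p → ℝ)) (X : Ω → Matrix (Fin p) (Fin n) ℝ) (ω : Ω) :
    Shrinkage.centerAt (Shrinkage.popMean ν) (X ω) = ofCols (centeredCols ν X ω) := rfl

theorem covKnown_eq (ν : Measure (Fin p → ℝ)) (X : Ω → Matrix (Fin p) (Fin n) ℝ) (ω : Ω) :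
    Shrinkage.covKnown (Shrinkage.popMean ν) (X ω)
      = Shrinkage.covKnown 0 (ofCols (centeredCols ν X ω)) := by
  simp only [Shrinkage.covKnown, centerAt_zero, centerAt_popMean]

theorem vhatKnown_eq (ν : Measure (Fin p → ℝ)) (X : Ω → Matrix (Fin p) (Fin n) ℝ) (ω : Ω) :
    Shrinkage.vhatKnown (Shrinkage.popMean ν) (X ω)
      = Shrinkage.vhatKnown 0 (ofCols (centeredCols ν X ω)) := by
  simp only [Shrinkage.vhatKnown, covKnown_eq, centerAt_zero, centerAt_popMean]

theorem vhatTargetKnown_eq (ν : Measure (Fin p → ℝ)) (T : Matrix (Fin p) (Fin p) ℝ)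
    (X : Ω → Matrix (Fin p) (Fin n) ℝ) (ω : Ω) :
    Shrinkage.vhatTargetKnown (Shrinkage.popMean ν) T (X ω)
      = Shrinkage.vhatTargetKnown 0 T (ofCols (centeredCols ν X ω)) := by
  simp only [Shrinkage.vhatTargetKnown, covKnown_eq, centerAt_zero, centerAt_popMean]

/-- Empirical centering is invariant under translation of all observations, so the unknown-mean
estimators may be studied on centered data. -/
theorem centerEmp_eq (hn : 1 ≤ n) (ν : Measure (Fin p → ℝ)) (X : Ω → Matrix (Fin p) (Fin n) ℝ)
    (ω : Ω) :
    Shrinkage.centerEmp (X ω) = Shrinkage.centerEmp (ofCols (centeredCols ν X ω)) := by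
  have hn0 : (n : ℝ) ≠ 0 := by positivity
  ext i k
  simp only [Shrinkage.centerEmp, ofCols, centeredCols, Matrix.of_apply, Pi.sub_apply,
    Finset.sum_sub_distrib, Finset.sum_const, Finset.card_univ, Fintype.card_fin, nsmul_eq_mul]
  field_simp
  ring

theorem covUnknown_eq (hn : 1 ≤ n) (ν : Measure (Fin p → ℝ)) (X : Ω → Matrix (Fin p) (Fin n) ℝ)
    (ω : Ω) :
    Shrinkage.covUnknown (X ω) = Shrinkage.covUnknown (ofCols (centeredCols ν X ω)) := by
  rw [Shrinkage.covUnknown, Shrinkage.covUnknown, centerEmp_eq hn ν]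

theorem vhatUnknown_eq (hn : 1 ≤ n) (ν : Measure (Fin p → ℝ)) (X : Ω → Matrix (Fin p) (Fin n) ℝ)
    (ω : Ω) :
    Shrinkage.vhatUnknown (X ω) = Shrinkage.vhatUnknown (ofCols (centeredCols ν X ω)) := by
  rw [Shrinkage.vhatUnknown, Shrinkage.vhatUnknown, Shrinkage.bbar, Shrinkage.bbar,
    covUnknown_eq hn ν, centerEmp_eq hn ν]

theorem vhatTargetUnknown_eq_centered (hn : 1 ≤ n) (ν : Measure (Fin p → ℝ))
    (T : Matrix (Fin p) (Fin p) ℝ) (X : Ω → Matrix (Fin p) (Fin n) ℝ) (ω : Ω) :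
    Shrinkage.vhatTargetUnknown T (X ω)
      = Shrinkage.vhatTargetUnknown T (ofCols (centeredCols ν X ω)) := by
  rw [Shrinkage.vhatTargetUnknown, Shrinkage.vhatTargetUnknown, Shrinkage.bbarTarget,
    Shrinkage.bbarTarget, covUnknown_eq hn ν, centerEmp_eq hn ν]

end Centering

/-! ### Passage to the limit. -/

section Limits

theorem tendstoZeroQM_of_le {Ω : ℕ → Type*} [∀ n, MeasurableSpace (Ω n)]
    {P : ∀ n, Measure (Ω n)} {Z : ∀ n, Ω n → ℝ} {n₀ : ℕ} {C : ℝ}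
    (h : ∀ n, n₀ ≤ n → MemLp (Z n) 2 (P n) ∧ ∫ ω, Z n ω ^ 2 ∂(P n) ≤ C / n) :
    Shrinkage.TendstoZeroQM P Z :=
  ⟨eventually_atTop.2 ⟨n₀, fun n hn => (h n hn).1⟩,
    squeeze_zero' (Eventually.of_forall fun _ => integral_nonneg fun _ => sq_nonneg _)
      (eventually_atTop.2 ⟨n₀, fun n hn => (h n hn).2⟩)
      (tendsto_const_nhds.div_atTop tendsto_natCast_atTop_atTop)⟩

/-- Since p⁴/(n³p²) = (p/n)²/n, bounded p/n leaves a rate 1/n. -/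
theorem variance_bound_le {n p : ℕ} (hn : 1 ≤ n) (hp : 1 ≤ p) {K₁ K₂ : ℝ} (hK₂ : 0 ≤ K₂)
    (h : (p : ℝ) / n ≤ K₁) :
    16384 * (256 * (K₂ * p ^ 4)) / (n ^ 3 * p ^ 2) ≤ 16384 * 256 * K₂ * K₁ ^ 2 / n := by
  have hn0 : (0 : ℝ) < n := by exact_mod_cast hn
  have hp0 : (0 : ℝ) < p := by exact_mod_cast hp
  calc _ = 16384 * 256 * K₂ * ((p : ℝ) / n) ^ 2 / n := by
        field_simp
    _ ≤ _ := by gcongr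

end Limits

end UStat

/-! ### Assembly of the theorem. -/

theorem theorem1
    {Ω : ℕ → Type*} [∀ n, MeasurableSpace (Ω n)]
    (P : ∀ n, Measure (Ω n)) [∀ n, IsProbabilityMeasure (P n)]
    (p N : ℕ → ℕ) (hp : ∀ n, 1 ≤ n → 1 ≤ p n) (hN : ∀ n, 1 ≤ n → 1 ≤ N n)
    (ν : ∀ n, Measure (Fin (p n) → ℝ))
    (X : ∀ n, Ω n → Matrix (Fin (p n)) (Fin n) ℝ)
    (hX : ∀ n, 1 ≤ n → Shrinkage.IsIIDSample (P n) (X n) (ν n))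
    (G : ∀ n, Matrix (Fin (p n)) (Fin (p n)) ℝ) (lam : ∀ n, Fin (p n) → ℝ)
    (hG : ∀ n, 1 ≤ n →
      Shrinkage.IsSpectralDecomposition (Shrinkage.popCov (ν n)) (G n) (lam n))
    (T : ∀ n, Fin (N n) → Matrix (Fin (p n)) (Fin (p n)) ℝ)
    (hT : ∀ n, 1 ≤ n → Shrinkage.IsTargetFamily (T n))
    (h1 : Shrinkage.DimensionAssumption p)
    (h2 : Shrinkage.MomentAssumption ν G T)
    (h3 : Shrinkage.TargetCountAssumption N)
    (h4 : Shrinkage.CovarianceAssumption ν G) :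
    -- known mean
    ((∀ n, 2 ≤ n →
        Integrable (fun ω => Shrinkage.norm
          (Shrinkage.covKnown (Shrinkage.popMean (ν n)) (X n ω) - Shrinkage.popCov (ν n)) ^ 2)
          (P n) ∧
        Shrinkage.IsUnbiased (P n)
          (fun ω => Shrinkage.vhatKnown (Shrinkage.popMean (ν n)) (X n ω))
          (Shrinkage.variance (P n)
            (fun ω => Shrinkage.covKnown (Shrinkage.popMean (ν n)) (X n ω))
            (Shrinkage.popCov (ν n))) ∧
        ∀ i,
          Integrable (fun ω => Shrinkage.inner
            (Shrinkage.covKnown (Shrinkage.popMean (ν n)) (X n ω) - Shrinkage.popCov (ν n))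
            (T n i) ^ 2) (P n) ∧
          Shrinkage.IsUnbiased (P n)
            (fun ω => Shrinkage.vhatTargetKnown (Shrinkage.popMean (ν n)) (T n i) (X n ω))
            (Shrinkage.varianceTarget (P n)
              (fun ω => Shrinkage.covKnown (Shrinkage.popMean (ν n)) (X n ω))
              (Shrinkage.popCov (ν n)) (T n i))) ∧
      Shrinkage.TendstoZeroQM P (fun n ω =>
        Shrinkage.vhatKnown (Shrinkage.popMean (ν n)) (X n ω) -
          Shrinkage.variance (P n)
            (fun ω' => Shrinkage.covKnown (Shrinkage.popMean (ν n)) (X n ω'))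
            (Shrinkage.popCov (ν n))) ∧
      Shrinkage.TendstoZeroQM P (fun n ω =>
        ∑ i, (Shrinkage.vhatTargetKnown (Shrinkage.popMean (ν n)) (T n i) (X n ω) -
          Shrinkage.varianceTarget (P n)
            (fun ω' => Shrinkage.covKnown (Shrinkage.popMean (ν n)) (X n ω'))
            (Shrinkage.popCov (ν n)) (T n i)))) ∧
    -- unknown mean
    ((∀ n, 4 ≤ n →
        Integrable (fun ω => Shrinkage.norm
          (Shrinkage.covUnknown (X n ω) - Shrinkage.popCov (ν n)) ^ 2) (P n) ∧
        Shrinkage.IsUnbiased (P n)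
          (fun ω => Shrinkage.vhatUnknown (X n ω))
          (Shrinkage.variance (P n) (fun ω => Shrinkage.covUnknown (X n ω))
            (Shrinkage.popCov (ν n))) ∧
        ∀ i,
          Integrable (fun ω => Shrinkage.inner
            (Shrinkage.covUnknown (X n ω) - Shrinkage.popCov (ν n)) (T n i) ^ 2) (P n) ∧
          Shrinkage.IsUnbiased (P n)
            (fun ω => Shrinkage.vhatTargetUnknown (T n i) (X n ω))
            (Shrinkage.varianceTarget (P n) (fun ω => Shrinkage.covUnknown (X n ω))
              (Shrinkage.popCov (ν n)) (T n i))) ∧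
      Shrinkage.TendstoZeroQM P (fun n ω =>
        Shrinkage.vhatUnknown (X n ω) -
          Shrinkage.variance (P n) (fun ω' => Shrinkage.covUnknown (X n ω'))
            (Shrinkage.popCov (ν n))) ∧
      Shrinkage.TendstoZeroQM P (fun n ω =>
        ∑ i, (Shrinkage.vhatTargetUnknown (T n i) (X n ω) -
          Shrinkage.varianceTarget (P n) (fun ω' => Shrinkage.covUnknown (X n ω'))
            (Shrinkage.popCov (ν n)) (T n i)))) := by
  obtain ⟨K₁, hK₁⟩ := h1
  obtain ⟨K₂, hK₂⟩ := h2
  have hmom := fun n (hn : 1 ≤ n) => UStat.integral_dotProduct_self_pow_le (ν n) (hp n hn)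
    (hG n hn).1 (hK₂ n hn).1 (hK₂ n hn).2.1
  have hs := fun n (hn : 1 ≤ n) =>
    UStat.isCenteredSample_centeredCols (hX n hn) hn (hmom n hn).1 (hmom n hn).2
  -- The case n = 1 suffices: there `K₂` dominates an average of even moments.
  have hK0 : 0 ≤ K₂ := by
    refine le_trans ?_ (hK₂ 1 le_rfl).2.1
    exact mul_nonneg (by positivity) (Finset.sum_nonneg fun i _ => integral_nonneg fun x =>
      Even.pow_nonneg (by decide) _)
  have hbd := fun n (hn : 1 ≤ n) => UStat.variance_bound_le hn (hp n hn) hK0 (hK₁ n hn)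
  set C := 16384 * 256 * K₂ * K₁ ^ 2
  have hB := fun n (hn : 1 ≤ n) => UStat.isBessel_of_orthonormal (hT n hn).2
  refine ⟨⟨fun n hn => ?_, UStat.tendstoZeroQM_of_le (n₀ := 2) (C := C) fun n hn => ?_,
    UStat.tendstoZeroQM_of_le (n₀ := 2) (C := C) fun n hn => ?_⟩,
    ⟨fun n hn => ?_, UStat.tendstoZeroQM_of_le (n₀ := 4) (C := C) fun n hn => ?_,
    UStat.tendstoZeroQM_of_le (n₀ := 4) (C := C) fun n hn => ?_⟩⟩
  · have hn1 : 1 ≤ n := by omega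
    simp only [UStat.covKnown_eq, UStat.vhatKnown_eq, UStat.vhatTargetKnown_eq]
    obtain ⟨⟨a, b⟩, -⟩ := (hs n hn1).known (hp n hn1) hn
    exact ⟨a, b, fun i => (hs n hn1).knownTarget hn ((hT n hn1).1 i)⟩
  · have hn1 : 1 ≤ n := by omega
    simp only [UStat.covKnown_eq, UStat.vhatKnown_eq]
    obtain ⟨-, a, b⟩ := (hs n hn1).known (hp n hn1) hn
    exact ⟨a, b.trans (hbd n hn1)⟩
  · have hn1 : 1 ≤ n := by omega
    simp only [UStat.covKnown_eq, UStat.vhatTargetKnown_eq]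
    obtain ⟨a, b⟩ := (hs n hn1).knownTarget_sum (hp n hn1) hn (hT n hn1).1 (hB n hn1)
    exact ⟨a, b.trans (hbd n hn1)⟩
  · have hn1 : 1 ≤ n := by omega
    simp only [UStat.covUnknown_eq hn1 (ν n) (X n), UStat.vhatUnknown_eq hn1 (ν n) (X n),
      UStat.vhatTargetUnknown_eq_centered hn1 (ν n) _ (X n)]
    obtain ⟨⟨a, b⟩, -⟩ := (hs n hn1).unknown (hp n hn1) hn
    exact ⟨a, b, fun i => (hs n hn1).unknownTarget (hp n hn1) hn ((hT n hn1).1 i)⟩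
  · have hn1 : 1 ≤ n := by omega
    simp only [UStat.covUnknown_eq hn1 (ν n) (X n), UStat.vhatUnknown_eq hn1 (ν n) (X n)]
    obtain ⟨-, a, b⟩ := (hs n hn1).unknown (hp n hn1) hn
    exact ⟨a, b.trans (hbd n hn1)⟩
  · have hn1 : 1 ≤ n := by omega
    simp only [UStat.covUnknown_eq hn1 (ν n) (X n), UStat.vhatTargetUnknown_eq_centered hn1 (ν n) _ (X n)]
    obtain ⟨a, b⟩ := (hs n hn1).unknownTarget_sum (hp n hn1) hn (hT n hn1).1 (hB n hn1)
    exact ⟨a, b.trans (hbd n hn1)⟩
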